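/- **Conventions.** A deterministic 1D cellular automaton $A$ with $n$ states has its cells indexed by $\mathbb{Z}$ and a rule $(x,s,y)\mapsto s'$ giving the new state of a cell in state $s$ whose left and right neighbours are in states $x$ and $y$. The pentagrid $\{5,4\}$, heptagrid $\{7,3\}$ and dodecagrid $\{5,3,4\}$ are the tilings of the hyperbolic plane, respectively hyperbolic $3$-space, generated from a regular right-angled pentagon, a regular heptagon with angles $2\pi/3$, a regular dodecahedron with right dihedral angles, by recursive reflection of tiles in their faces. A deterministic cellular automaton on a grid gives the new state of a cell as a function of its state and of the states seen through its $5$, $7$ or $12$ faces, which are numbered in each tile as the image of a fixed numbering of the central tile under some orientation-preserving motion. It is *rotation invariant* if contexts that differ by an orientation-preserving motion leaving the tile globally invariant always produce the same new state. A *line of tiles* consists of the translates of a tile by a shift along a guideline that carries the tile to one of its neighbours. In the pentagrid the guideline supports a side of the tile; in the heptagrid it joins the midpoints of two contiguous sides of it; in the dodecagrid it supports an edge of it. The line is directed from left to right, in the pentagrid and the heptagrid in such a way that the guideline is on the right-hand side of the tiles' centres. An automaton is given to an algorithm by its number of states and the list of its rules. **Theorem 1.** Each of the three grids has lines of tiles,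 the tiles of a line being pairwise distinct and indexed by $\mathbb{Z}$. There is a uniform algorithm which transforms any deterministic 1D cellular automaton $A$ with $n$ states, for each of the three grids, into a deterministic, rotation-invariant cellular automaton $B$ on that grid with $n+1$ states (those of $A$ and one extra state), such that $B$ simulates $A$ step by step on every line of tiles, whatever the numbering of the faces of the tiles and whatever the initial configuration of $A$. That is, if a configuration of the grid carries a configuration of $A$ on the line and a certain background off the line, then after $t$ steps of $B$ it carries on the line the configuration of $A$ after $t$ steps, and the background is unchanged, for all $t\ge 0$. The background is as follows. * In the pentagrid and in the heptagrid, the extra state marks all the cells off the line. * In the dodecagrid, each cell of the line has one marked neighbour off the line, always seen through the same face up to the shift along the guideline (a fixed face which is adjacent to the face shared with the right-hand neighbour of the cell on the line and to exactly one of the two faces of the cell that meet along the guideline). The marked cells are in a fixed state of $A$, and the extra state marks all the other cells off the line. If moreover the rule of $A$ is symmetric, that is, $(x,s,y)$ and $(y,s,x)$ always give the same new state, then the same automaton $B$ also simulates $A$ in the dodecagrid with the extra state marking all the cells off the line. -/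

import Mathlib

noncomputable section

namespace HypCA

/-! ### Hyperbolic space: the hyperboloid model -/

/-- The ambient space `ℝ^{d,1}` of the hyperboloid model of hyperbolic `d`-space. -/
abbrev Mink (d : ℕ) : Type := Fin (d + 1) → ℝ

/-- The Minkowski form `-x₀y₀ + x₁y₁ + ⋯ + x_d y_d`. -/
def mink {d : ℕ} (x y : Mink d) : ℝ := -(x 0 * y 0) + ∑ i : Fin d, x i.succ * y i.succ

/-- Hyperbolic `d`-space: the upper sheet of the hyperboloid. -/
def hypSpace (d : ℕ) : Set (Mink d) := {x | mink x x = -1 ∧ 0 < x 0}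

/-- The reflection in the hyperplane of hyperbolic space with unit normal vector `v`. -/
def reflection {d : ℕ} (v x : Mink d) : Mink d := x - (2 * mink x v) • v

/-- The group of positive motions (orientation preserving isometries) of hyperbolic `d`-space:
the linear maps of determinant `1` which preserve the Minkowski form and the upper sheet. -/
def positiveMotions (d : ℕ) : Subgroup (Mink d ≃ₗ[ℝ] Mink d) where
  carrier := {g | (∀ x y, mink (g x) (g y) = mink x y) ∧
    (∀ x, g x ∈ hypSpace d ↔ x ∈ hypSpace d) ∧ LinearEquiv.det g = 1}
  mul_mem' := by
    rintro g h ⟨hg1, hg2, hg3⟩ ⟨hh1, hh2, hh3⟩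
    refine ⟨fun x y => ?_, fun x => ?_, ?_⟩
    · rw [LinearEquiv.mul_apply, LinearEquiv.mul_apply, hg1, hh1]
    · rw [LinearEquiv.mul_apply, hg2, hh2]
    · rw [map_mul, hg3, hh3, one_mul]
  one_mem' := ⟨fun _ _ => rfl, fun _ => Iff.rfl, map_one _⟩
  inv_mem' := by
    rintro g ⟨hg1, hg2, hg3⟩
    have key : ∀ x, g (g⁻¹ x) = x := fun x => g.apply_symm_apply x
    refine ⟨fun x y => ?_, fun x => ?_, ?_⟩
    · rw [← hg1, key, key]
    · rw [← hg2, key]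
    · rw [map_inv, hg3, inv_one]

/-! ### The three grids -/

/-- The pentagrid `{5,4}`, the heptagrid `{7,3}` and the dodecagrid `{5,3,4}`. -/
inductive Grid
  | pentagrid
  | heptagrid
  | dodecagrid

/-- The dimension of the hyperbolic space tiled by the grid. -/
abbrev Grid.dim : Grid → ℕ
  | .pentagrid => 2
  | .heptagrid => 2
  | .dodecagrid => 3

/-- The number of faces (sides, in the plane) of a tile. -/
abbrev Grid.faces : Grid → ℕ
  | .pentagrid => 5
  | .heptagrid => 7
  | .dodecagrid => 12

/-- `cosh r`, where `r` is the inradius of the regular hyperbolic `p`-gon with angles `2π/q`. -/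
def polygonCosh (p q : ℕ) : ℝ := Real.cos (Real.pi / q) / Real.sin (Real.pi / p)

/-- `sinh r`, where `r` is the inradius of the regular hyperbolic `p`-gon with angles `2π/q`. -/
def polygonSinh (p q : ℕ) : ℝ := √(polygonCosh p q ^ 2 - 1)

/-- The outward unit normals of the sides of the regular `p`-gon with angles `2π/q` centred at
`(1,0,0)`. The sides are numbered clockwise. -/
def polygonNormal (p q : ℕ) (i : Fin p) : Mink 2 :=
  ![polygonSinh p q,
    polygonCosh p q * Real.cos (2 * Real.pi * (i : ℕ) / p),
    -(polygonCosh p q * Real.sin (2 * Real.pi * (i : ℕ) / p))]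

/-- The midpoints of the sides of the same polygon. -/
def polygonMidpoint (p q : ℕ) (i : Fin p) : Mink 2 :=
  ![polygonCosh p q,
    polygonSinh p q * Real.cos (2 * Real.pi * (i : ℕ) / p),
    -(polygonSinh p q * Real.sin (2 * Real.pi * (i : ℕ) / p))]

/-- The Euclidean outward unit normals of the faces of a regular dodecahedron (the vertices of an
icosahedron). Face `0` is surrounded by `1, …, 5`, face `11` is opposite to face `0`, and
face `6 + j` touches face `11` and, for `1 ≤ j ≤ 4`, the faces `j` and `j + 1`; face `6`
touches the faces `5` and `1`. -/
def dodecahedronDirection (i : Fin 12) : Fin 3 → ℝ :=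
  if i.val = 0 then ![0, 0, 1]
  else if i.val ≤ 5 then
    ![2 / √5 * Real.cos (2 * Real.pi * (i.val - 1) / 5),
      2 / √5 * Real.sin (2 * Real.pi * (i.val - 1) / 5), 1 / √5]
  else if i.val ≤ 10 then
    ![2 / √5 * Real.cos (2 * Real.pi * (i.val - 6) / 5 - Real.pi / 5),
      2 / √5 * Real.sin (2 * Real.pi * (i.val - 6) / 5 - Real.pi / 5), -(1 / √5)]
  else ![0, 0, -1]

/-- The outward unit normals of the faces of the regular hyperbolic dodecahedron with right
dihedral angles centred at `(1,0,0,0)`: its inradius `r` satisfies `tanh² r = 1/√5`. -/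
def dodecahedronNormal (i : Fin 12) : Mink 3 :=
  Matrix.vecCons (√(1 / (√5 - 1))) fun k => √(√5 / (√5 - 1)) * dodecahedronDirection i k

/-- The outward unit normals of the faces of the central tile of the grid. The central tile is
`{x ∈ hypSpace | mink x (normal i) ≤ 0 for all i}`. -/
def Grid.normal : (G : Grid) → Fin G.faces → Mink G.dim
  | .pentagrid => polygonNormal 5 4
  | .heptagrid => polygonNormal 7 3
  | .dodecagrid => dodecahedronNormal

/-- The tiles of the grid. A convex polytope is given by the set of the outward unit normals of
its faces, i.e. by the half-spaces which it is the intersection of. The tiling is generated from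
the central tile by reflecting tiles in their faces, recursively. -/
inductive IsTile (G : Grid) : Set (Mink G.dim) → Prop
  | central : IsTile G (Set.range G.normal)
  | reflect {T : Set (Mink G.dim)} {v : Mink G.dim} (hT : IsTile G T) (hv : v ∈ T) :
      IsTile G (reflection v '' T)

/-- The type of the tiles (cells) of the grid. -/
def Tile (G : Grid) : Type := {T : Set (Mink G.dim) // IsTile G T}

/-- The neighbour which the tile `T` sees through its face with outward normal `v`. -/
def Tile.neighbour {G : Grid} (T : Tile G) (v : Mink G.dim) (hv : v ∈ T.1) : Tile G :=
  ⟨reflection v '' T.1, IsTile.reflect T.2 hv⟩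

/-- A positive motion which carries the central tile to `T`. It transports the numbering of the
faces of the central tile to the faces of `T`, respecting the orientation. -/
structure Placement {G : Grid} (T : Tile G) where
  motion : Mink G.dim ≃ₗ[ℝ] Mink G.dim
  motion_mem : motion ∈ positiveMotions G.dim
  image_eq : motion '' Set.range G.normal = T.1

/-- The neighbour of `T` through its face number `i`. -/
def Placement.neighbour {G : Grid} {T : Tile G} (P : Placement T) (i : Fin G.faces) : Tile G :=
  T.neighbour (P.motion (G.normal i)) (P.image_eq ▸ ⟨G.normal i, ⟨i, rfl⟩, rfl⟩)

/-- A numbering of the faces of all the tiles: in each tile, the faces are numbered as a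
rotated image of the numbering of the central tile. -/
abbrev Numbering (G : Grid) : Type := (T : Tile G) → Placement T

/-! ### Lines of tiles -/

/-- The face through which a cell of a line sees its left-hand side neighbour of the line. -/
def Grid.left : (G : Grid) → Fin G.faces
  | .pentagrid => 1
  | .heptagrid => 1
  | .dodecagrid => 1

/-- The face through which a cell of a line sees its right-hand side neighbour of the line. -/
def Grid.right : (G : Grid) → Fin G.faces
  | .pentagrid => 4
  | .heptagrid => 5
  | .dodecagrid => 4

/-- Vectors whose orthogonal complement cuts the guideline out of hyperbolic space. In the
pentagrid, the guideline supports side `0` of the central tile; in the heptagrid, it joins the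
midpoints of the contiguous sides `6` and `0`; in the dodecagrid, it supports the edge shared by
the faces `0` and `5`. -/
def Grid.guide : (G : Grid) → Set (Mink G.dim)
  | .pentagrid => {polygonNormal 5 4 0}
  | .heptagrid => {w | mink w (polygonMidpoint 7 3 6) = 0 ∧ mink w (polygonMidpoint 7 3 0) = 0}
  | .dodecagrid => {dodecahedronNormal 0, dodecahedronNormal 5}

/-- A line of tiles, directed from left to right, with a placement of each of its tiles. Each
tile is obtained from the preceding one by the shift along the guideline, which turns the
left-hand side face of a cell into its right-hand side face (seen from the other side). -/
structure Line (G : Grid) where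
  tile : ℤ → Tile G
  place : (k : ℤ) → Placement (tile k)
  guide_eq : ∀ k, ∀ w ∈ G.guide, (place (k + 1)).motion w = (place k).motion w
  left_eq : ∀ k, (place (k + 1)).motion (G.normal G.left) = -(place k).motion (G.normal G.right)

/-! ### Cellular automata -/

/-- A deterministic one-dimensional cellular automaton with `n` states: `rule x s y` is the new
state of a cell in state `s` with left neighbour in state `x` and right neighbour in state `y`. -/
structure LineCA (n : ℕ) where
  rule : Fin n → Fin n → Fin n → Fin n

/-- One step of the one-dimensional automaton on the bi-infinite line of cells. -/
def LineCA.step {n : ℕ} (A : LineCA n) (x : ℤ → Fin n) : ℤ → Fin n :=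
  fun k => A.rule (x (k - 1)) (x k) (x (k + 1))

/-- The rules do not distinguish left from right. -/
def LineCA.Symmetric {n : ℕ} (A : LineCA n) : Prop := ∀ x s y, A.rule x s y = A.rule y s x

/-- A deterministic cellular automaton with `m` states on the grid: `rule s c` is the new state
of a cell in state `s` which sees a cell in state `c i` through its face number `i`. -/
structure GridCA (G : Grid) (m : ℕ) where
  rule : Fin m → (Fin G.faces → Fin m) → Fin m

/-- One step of the automaton on the grid, the faces being numbered by `ν`. -/
def GridCA.step {G : Grid} {m : ℕ} (B : GridCA G m) (ν : Numbering G) (c : Tile G → Fin m) :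
    Tile G → Fin m :=
  fun T => B.rule (c T) fun i => c ((ν T).neighbour i)

/-- Rotation invariance: a positive motion leaving the central tile globally invariant permutes
its faces, and contexts which are rotated forms of each other produce the same new state. -/
def GridCA.RotationInvariant {G : Grid} {m : ℕ} (B : GridCA G m) : Prop :=
  ∀ g ∈ positiveMotions G.dim, ∀ μ : Equiv.Perm (Fin G.faces),
    (∀ i, g (G.normal i) = G.normal (μ i)) →
      ∀ (s : Fin m) (c : Fin G.faces → Fin m), B.rule s (fun i => c (μ i)) = B.rule s c

/-! ### Simulation on a line -/

open Classical in
/-- The configuration of the grid which carries the configuration `x` on the line `ℓ`. The cells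
of the line hold the states of `x`. A cell off the line is in the extra state `Fin.last n`, except
that the cells which a cell of the line sees through a face in `marks` are in the state `0`, the
first of the `n` states of the one-dimensional automaton. -/
def Line.embed {G : Grid} {n : ℕ} (ℓ : Line G) (marks : Set (Fin G.faces)) (x : ℤ → Fin n) :
    Tile G → Fin (n + 1) :=
  Function.extend ℓ.tile (fun k => (x k).castSucc) fun T =>
    if ∃ k, ∃ i ∈ marks, (ℓ.place k).neighbour i = T then 0 else Fin.last n

/-- `B` simulates `A`, step by step, on every line of the grid, the cells off the line being in
the extra state apart from the marked ones. -/
def GridCA.SimulatesOnLines {G : Grid} {n : ℕ} (B : GridCA G (n + 1)) (A : LineCA n)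
    (marks : Set (Fin G.faces)) : Prop :=
  ∀ (ν : Numbering G) (ℓ : Line G) (x : ℤ → Fin n) (t : ℕ),
    (B.step ν)^[t] (ℓ.embed marks x) = ℓ.embed marks (A.step^[t] x)

/-- No cell is marked in the plane; in the dodecagrid, a cell of the line has one marked
neighbour, through its face number `3`. -/
def Grid.marks : (G : Grid) → Set (Fin G.faces)
  | .pentagrid => ∅
  | .heptagrid => ∅
  | .dodecagrid => {3}

/-! ### Cellular automata as inputs and outputs of algorithms -/

/-- The code of an automaton: its number of states and a list of its rules, which are words
over the natural numbers. -/
abbrev Code : Type := ℕ × List (List ℕ)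

/-- `p` codes the one-dimensional automaton `A`: it consists of the number of states and of a
list of all the rules of `A`, a rule being a word `x s y s'`. -/
def LineCA.IsCode {n : ℕ} (A : LineCA n) (p : Code) : Prop :=
  p.1 = n ∧ ∀ w : List ℕ, w ∈ p.2 ↔
    ∃ x s y : Fin n, w = [x.val, s.val, y.val, (A.rule x s y).val]

/-- `p` codes the automaton `B` on the grid: it consists of the number of states and of a list
of all the rules of `B`, a rule being a word which consists of the current state, the states of
the neighbours and the new state. -/
def GridCA.IsCode {G : Grid} {m : ℕ} (B : GridCA G m) (p : Code) : Prop :=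
  p.1 = m ∧ ∀ w : List ℕ, w ∈ p.2 ↔
    ∃ (s : Fin m) (c : Fin G.faces → Fin m),
      w = s.val :: (List.ofFn fun i => (c i).val) ++ [(B.rule s c).val]

end HypCA

end

noncomputable section

namespace HypCA

open Finset

/-! ### Minkowski space -/

section Mink

variable {d : ℕ}

/-! Geometry. Everything is computed in the hyperboloid model. All placements along a line act in
the same way on the vectors that cut out the guideline, and consecutive cells share a wall. This
forces consecutive placements to differ by the translation `shift`, and the walls to satisfy `W (k +
1) = 2 C W k - W (k - 1)`, where `C` is the hyperbolic cosine of the shift length `L`. Products of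
walls are therefore the numbers `cosh (m L)`. The centre of a cell is a combination of its two walls
plus a constant vector, so the distances between centres are explicit as well. Tiles are told apart
by their centres, which are proportional to the sums of their normals. Hence the tiles of a line are
distinct, and a cell of the line sees other cells of the line only through its left-hand and
right-hand faces (`neighbour_eq_tile`). In the dodecagrid the same computation locates the marked
cells (`eq_of_mink_markCentre`).

Automaton. A cell applies the rule of `A` only when its context is a rotated form of the context of
a cell on a line; in all other contexts it keeps its state. Rotation invariance is then built in,
provided that an active context determines the states `x`, `y` of the neighbours on the line
(`Grid.Readable`). In the plane, an ambiguity would give a rotation of the tile which exchanges the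
left and right faces; such a motion fixes the centre, so it is a mirror, of determinant `-1`. In the
dodecagrid a half-turn does exchange the two faces, whence the mark: among the faces left, right and
mark, only the left one is adjacent to neither of the others. Without a mark only the unordered pair
of neighbour states is readable; the automaton then applies the rule to the sorted pair, which
suffices for symmetric rules.

Background. A cell in the extra state never acts. An active context contains at least two states
other than the extra one, whereas a marked cell sees at most one such state, so it does not act
either (`simulates`).

Algorithm. The rotated labellings form a finite table which depends on the grid only; listing the
active contexts and then all the remaining ones is primitive recursive. -/

theorem mink_comm (x y : Mink d) : mink x y = mink y x := by
  simp [mink, mul_comm]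

theorem mink_add_left (x y z : Mink d) : mink (x + y) z = mink x z + mink y z := by
  simp only [mink, Pi.add_apply, add_mul, sum_add_distrib]; ring

theorem mink_smul_left (a : ℝ) (x z : Mink d) : mink (a • x) z = a * mink x z := by
  simp only [mink, Pi.smul_apply, smul_eq_mul, mul_add, mul_sum, mul_assoc]; ring

theorem mink_neg_left (x z : Mink d) : mink (-x) z = -mink x z := by
  rw [← neg_one_smul ℝ x, mink_smul_left]; ring

theorem mink_sub_left (x y z : Mink d) : mink (x - y) z = mink x z - mink y z := by
  rw [sub_eq_add_neg, mink_add_left, mink_neg_left]; ring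

theorem mink_add_right (x y z : Mink d) : mink x (y + z) = mink x y + mink x z := by
  rw [mink_comm, mink_add_left, mink_comm y, mink_comm z]

theorem mink_smul_right (a : ℝ) (x z : Mink d) : mink x (a • z) = a * mink x z := by
  rw [mink_comm, mink_smul_left, mink_comm z]

theorem mink_neg_right (x z : Mink d) : mink x (-z) = -mink x z := by
  rw [mink_comm, mink_neg_left, mink_comm z]

theorem mink_sub_right (x y z : Mink d) : mink x (y - z) = mink x y - mink x z := by
  rw [mink_comm, mink_sub_left, mink_comm y, mink_comm z]

theorem mink_zero_left (x : Mink d) : mink 0 x = 0 := by simp [mink]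

/-- The Minkowski form, as a linear form in its first argument. -/
def minkForm (v : Mink d) : Mink d →ₗ[ℝ] ℝ where
  toFun x := mink x v
  map_add' x y := mink_add_left x y v
  map_smul' a x := mink_smul_left a x v

/-- The centre of the central tile. -/
def origin (d : ℕ) : Mink d := Pi.single 0 1

theorem mink_origin (x : Mink d) : mink x (origin d) = -x 0 := by
  simp [mink, origin]

theorem origin_mem_hypSpace : origin d ∈ hypSpace d := by
  refine ⟨?_, ?_⟩
  · rw [mink_origin]; simp [origin]
  · simp [origin]

theorem sq_lt_of_mink_self {x : Mink d} (hx : mink x x = -1) :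
    ∑ i : Fin d, x i.succ ^ 2 = x 0 ^ 2 - 1 := by
  have : ∑ i : Fin d, x i.succ * x i.succ = ∑ i : Fin d, x i.succ ^ 2 :=
    sum_congr rfl fun i _ => by ring
  rw [mink, this] at hx
  linarith

/-- By Cauchy–Schwarz on the space coordinates, two vectors of square `-1` whose time coordinates
had opposite signs could not have a negative product. The next criterion is the converse; together
they detect the sheet from the sign of the product. -/
theorem mem_hypSpace_of_mink_neg {x y : Mink d} (hx : x ∈ hypSpace d) (hy : mink y y = -1)
    (h : mink x y < 0) : y ∈ hypSpace d := by
  refine ⟨hy, ?_⟩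
  by_contra! hy0
  have hcs := sum_mul_sq_le_sq_mul_sq univ (fun i : Fin d => x i.succ) (fun i => y i.succ)
  rw [sq_lt_of_mink_self hx.1, sq_lt_of_mink_self hy] at hcs
  have hx0 := hx.2
  rw [mink] at h
  have h1 := sq_lt_of_mink_self hy
  have h2 : 0 ≤ ∑ i : Fin d, y i.succ ^ 2 := sum_nonneg fun i _ => sq_nonneg _
  have h3 : 0 ≤ ∑ i : Fin d, x i.succ ^ 2 := sum_nonneg fun i _ => sq_nonneg _
  rw [sq_lt_of_mink_self hx.1] at h3
  set S := ∑ i : Fin d, x i.succ * y i.succ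
  have h5 : 0 ≤ x 0 * (-y 0) := mul_nonneg hx0.le (by linarith)
  have h6 : (x 0 * -y 0) ^ 2 < S ^ 2 := by
    apply sq_lt_sq' <;> nlinarith
  nlinarith

theorem mink_neg_of_mem_hypSpace {x y : Mink d} (hx : x ∈ hypSpace d) (hy : y ∈ hypSpace d) :
    mink x y < 0 := by
  by_contra! h
  have hcs := sum_mul_sq_le_sq_mul_sq univ (fun i : Fin d => x i.succ) (fun i => y i.succ)
  rw [sq_lt_of_mink_self hx.1, sq_lt_of_mink_self hy.1] at hcs
  rw [mink] at h
  have hx0 := hx.2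
  have hy0 := hy.2
  have h2 : 0 ≤ ∑ i : Fin d, y i.succ ^ 2 := sum_nonneg fun i _ => sq_nonneg _
  have h3 : 0 ≤ ∑ i : Fin d, x i.succ ^ 2 := sum_nonneg fun i _ => sq_nonneg _
  rw [sq_lt_of_mink_self hx.1] at h3
  rw [sq_lt_of_mink_self hy.1] at h2
  set S := ∑ i : Fin d, x i.succ * y i.succ
  have h5 : 0 < x 0 * y 0 := mul_pos hx0 hy0
  have h6 : (x 0 * y 0) ^ 2 ≤ S ^ 2 := by
    apply sq_le_sq' <;> nlinarith
  nlinarith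

/-- The reflection in the hyperplane with unit normal vector `v`, as a linear automorphism. -/
def reflectionEquiv (v : Mink d) (hv : mink v v = 1) : Mink d ≃ₗ[ℝ] Mink d :=
  LinearEquiv.ofInvolutive
    { toFun := reflection v
      map_add' := fun x y => by simp only [reflection, mink_add_left]; module
      map_smul' := fun a x => by
        simp only [reflection, mink_smul_left, RingHom.id_apply]; module }
    (fun x => by
      simp only [LinearMap.coe_mk, AddHom.coe_mk, reflection, mink_sub_left, mink_smul_left, hv]
      module)

@[simp] theorem reflectionEquiv_apply (v : Mink d) (hv : mink v v = 1) (x : Mink d) :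
    reflectionEquiv v hv x = reflection v x := rfl

theorem reflection_reflection {v : Mink d} (hv : mink v v = 1) (x : Mink d) :
    reflection v (reflection v x) = x := by
  simp only [reflection, mink_sub_left, mink_smul_left, hv]
  module

theorem mink_reflection {v : Mink d} (hv : mink v v = 1) (x y : Mink d) :
    mink (reflection v x) (reflection v y) = mink x y := by
  simp only [reflection, mink_sub_left, mink_sub_right, mink_smul_left, mink_smul_right, hv,
    mink_comm v y]
  ring

theorem reflection_mem_hypSpace {v : Mink d} (hv : mink v v = 1) {x : Mink d}
    (hx : x ∈ hypSpace d) : reflection v x ∈ hypSpace d := by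
  refine mem_hypSpace_of_mink_neg hx (by rw [mink_reflection hv]; exact hx.1) ?_
  simp only [reflection, mink_sub_right, mink_smul_right, hx.1]
  nlinarith [sq_nonneg (mink x v)]

/-- A reflection is a transvection along `v` with the form `-2 ⟨·, v⟩`, so its determinant is `1 -
2`. -/
theorem det_reflectionEquiv (v : Mink d) (hv : mink v v = 1) :
    LinearEquiv.det (reflectionEquiv v hv) = -1 := by
  rw [← Units.val_inj, LinearEquiv.coe_det]
  have : (reflectionEquiv v hv : Mink d →ₗ[ℝ] Mink d)
      = LinearMap.transvection ((-2 : ℝ) • minkForm v) v := by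
    refine LinearMap.ext fun x => ?_
    rw [LinearMap.transvection.apply]
    simp [reflection, minkForm, sub_eq_add_neg]
  rw [this, LinearMap.transvection.det]
  simp [minkForm, hv]
  norm_num

/-- The isometries which preserve the upper sheet. -/
def IsMotion (g : Mink d ≃ₗ[ℝ] Mink d) : Prop :=
  (∀ x y, mink (g x) (g y) = mink x y) ∧ ∀ x, g x ∈ hypSpace d ↔ x ∈ hypSpace d

theorem IsMotion.mul {g h : Mink d ≃ₗ[ℝ] Mink d} (hg : IsMotion g) (hh : IsMotion h) :
    IsMotion (g * h) :=
  ⟨fun x y => by rw [LinearEquiv.mul_apply, LinearEquiv.mul_apply, hg.1, hh.1],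
    fun x => by rw [LinearEquiv.mul_apply, hg.2, hh.2]⟩

theorem isMotion_reflectionEquiv (v : Mink d) (hv : mink v v = 1) :
    IsMotion (reflectionEquiv v hv) := by
  refine ⟨fun x y => mink_reflection hv x y, fun x => ⟨fun h => ?_, reflection_mem_hypSpace hv⟩⟩
  have := reflection_mem_hypSpace hv h
  rwa [reflectionEquiv_apply, reflection_reflection hv] at this

theorem reflection_map {g : Mink d ≃ₗ[ℝ] Mink d} (hg : ∀ x y, mink (g x) (g y) = mink x y)
    (v x : Mink d) : reflection (g v) (g x) = g (reflection v x) := by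
  simp [reflection, hg]

theorem reflectionEquiv_mul_mem {v w : Mink d} (hv : mink v v = 1) (hw : mink w w = 1)
    {g : Mink d ≃ₗ[ℝ] Mink d} (hg : g ∈ positiveMotions d) :
    reflectionEquiv v hv * g * reflectionEquiv w hw ∈ positiveMotions d := by
  have h := ((isMotion_reflectionEquiv v hv).mul (g := reflectionEquiv v hv) (h := g)
    ⟨hg.1, hg.2.1⟩).mul (isMotion_reflectionEquiv w hw)
  refine ⟨h.1, h.2, ?_⟩
  rw [map_mul, map_mul, det_reflectionEquiv, det_reflectionEquiv, hg.2.2]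
  simp

theorem map_symm_eq {g : Mink d ≃ₗ[ℝ] Mink d} (hg : g ∈ positiveMotions d) (x y : Mink d) :
    mink (g⁻¹ x) y = mink x (g y) := by
  have key : g (g⁻¹ x) = x := g.apply_symm_apply x
  rw [← hg.1, key]

end Mink

/-! ### Grids with a line of tiles -/

/-- The metric data of a grid which govern its lines: the hyperbolic sine `s` of the inradius of
the tiles, the hyperbolic cosine `C` of the length of the shift, and a unit normal vector `b` of
the mirror which exchanges the left-hand and right-hand faces of the central tile. -/
structure Grid.Geometry (G : Grid) (s C : ℝ) (b : Mink G.dim) : Prop where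
  s_pos : 0 < s
  one_lt : 1 < C
  -- Equivalently, the component of the centre orthogonal to the left and right normals has
  -- non-negative square. This excludes a tile flipped to the lower sheet in `wall_recurrence`.
  le_two_sq : C - 1 ≤ 2 * s ^ 2
  norm : ∀ i, mink (G.normal i) (G.normal i) = 1
  height : ∀ i, mink (origin G.dim) (G.normal i) = -s
  sum : ∃ κ : ℝ, κ ≠ 0 ∧ ∑ i, G.normal i = κ • origin G.dim
  injective : Function.Injective G.normal
  left_right : mink (G.normal G.left) (G.normal G.right) = -C
  guide_left : ∀ w ∈ G.guide, mink w (G.normal G.left) = 0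
  guide_right : ∀ w ∈ G.guide, mink w (G.normal G.right) = 0
  span : ∀ y, (∀ w ∈ G.guide, mink w y = 0) →
    ∃ α β : ℝ, y = α • G.normal G.left + β • G.normal G.right
  -- The coefficient is the one that makes the difference orthogonal to both normals: each has
  -- product `-s` with the centre and `1 - C` with their sum.
  origin_mem : origin G.dim - (s / (C - 1)) • (G.normal G.left + G.normal G.right) ∈
    Submodule.span ℝ G.guide
  mirror_norm : mink b b = 1
  mirror_eq : ∃ t : ℝ, b = t • (G.normal G.left - G.normal G.right)
  mirror_perm : ∀ i, ∃ j, reflection b (G.normal i) = G.normal j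

namespace Grid.Geometry

variable {G : Grid} {s C : ℝ} {b : Mink G.dim}

theorem mirror_left (h : G.Geometry s C b) : reflection b (G.normal G.left) = G.normal G.right := by
  obtain ⟨t, rfl⟩ := h.mirror_eq
  have h1 := h.mirror_norm
  simp only [mink_smul_left, mink_smul_right, mink_sub_left, mink_sub_right, h.norm,
    h.left_right, mink_comm (G.normal G.right) (G.normal G.left)] at h1
  have h2 : 2 * (t * (1 - -C)) * t = 1 := by linarith
  rw [reflection, mink_smul_right, mink_sub_right, h.norm, h.left_right, smul_smul, h2]
  module

theorem mirror_guide (h : G.Geometry s C b) {w : Mink G.dim} (hw : w ∈ G.guide) :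
    mink w b = 0 := by
  obtain ⟨t, rfl⟩ := h.mirror_eq
  simp [mink_smul_right, mink_sub_right, h.guide_left w hw, h.guide_right w hw]

theorem mirror_origin (h : G.Geometry s C b) : reflection b (origin G.dim) = origin G.dim := by
  obtain ⟨t, ht⟩ := h.mirror_eq
  rw [reflection, ht, mink_smul_right, mink_sub_right, h.height, h.height]
  simp

theorem mirror_image (h : G.Geometry s C b) :
    reflection b '' Set.range G.normal = Set.range G.normal := by
  have h1 : ∀ v ∈ Set.range G.normal, reflection b v ∈ Set.range G.normal := by
    rintro _ ⟨i, rfl⟩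
    obtain ⟨j, hj⟩ := h.mirror_perm i
    exact ⟨j, hj.symm⟩
  refine Set.Subset.antisymm ?_ fun v hv => ⟨_, h1 v hv, reflection_reflection h.mirror_norm v⟩
  rintro _ ⟨v, hv, rfl⟩
  exact h1 v hv

theorem mem_tile_norm (h : G.Geometry s C b) {T : Set (Mink G.dim)} (hT : IsTile G T) :
    ∀ v ∈ T, mink v v = 1 := by
  induction hT with
  | central => rintro _ ⟨i, rfl⟩; exact h.norm i
  | reflect hT hv ih =>
    rintro _ ⟨u, hu, rfl⟩
    rw [mink_reflection (ih _ hv), ih u hu]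

/-! ### Existence of numberings and lines -/

/-- Reflecting a tile in a face reverses orientation; precomposing with the mirror `b`, which
preserves the central tile, restores determinant `1`. -/
theorem nonempty_placement (h : G.Geometry s C b) (T : Tile G) : Nonempty (Placement T) := by
  obtain ⟨T, hT⟩ := T
  have : ∃ g ∈ positiveMotions G.dim, g '' Set.range G.normal = T := by
    induction hT with
    | central => exact ⟨1, one_mem _, by simp⟩
    | @reflect T v hT hv ih =>
      obtain ⟨g, hg, rfl⟩ := ih
      have hv1 := h.mem_tile_norm hT v hv
      refine ⟨_, reflectionEquiv_mul_mem hv1 h.mirror_norm hg, ?_⟩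
      conv_rhs => rw [← h.mirror_image]
      simp only [Set.image_image]
      rfl
  obtain ⟨g, hg, hT'⟩ := this
  exact ⟨⟨g, hg, hT'⟩⟩

/-- Isometries conjugate reflections into reflections, so once the central tile goes to a tile, the
recursive generation of the tiling is carried along. -/
theorem isTile_image {u : Mink G.dim} (hu : mink u u = 1)
    (hc : IsTile G (reflection u '' Set.range G.normal)) {T : Set (Mink G.dim)} (hT : IsTile G T) :
    IsTile G (reflection u '' T) := by
  induction hT with
  | central => exact hc
  | @reflect T v hT hv ih =>
    have := IsTile.reflect ih (Set.mem_image_of_mem _ hv)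
    convert this using 1
    simp only [Set.image_image]
    refine Set.image_congr fun x _ => ?_
    exact (reflection_map (g := reflectionEquiv u hu) (mink_reflection hu) v x).symm

/-- The shift of the central tile to its right-hand side neighbour. -/
def shift (h : G.Geometry s C b) : Mink G.dim ≃ₗ[ℝ] Mink G.dim :=
  reflectionEquiv (G.normal G.right) (h.norm _) * reflectionEquiv b h.mirror_norm

theorem shift_apply (h : G.Geometry s C b) (x : Mink G.dim) :
    h.shift x = reflection (G.normal G.right) (reflection b x) := rfl

theorem shift_inv_apply (h : G.Geometry s C b) (x : Mink G.dim) :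
    h.shift⁻¹ x = reflection b (reflection (G.normal G.right) x) := by
  rw [shift, mul_inv_rev]; rfl

theorem shift_mem (h : G.Geometry s C b) : h.shift ∈ positiveMotions G.dim := by
  have := reflectionEquiv_mul_mem (h.norm G.right) h.mirror_norm (one_mem _)
  rwa [mul_one] at this

theorem shift_guide (h : G.Geometry s C b) {w : Mink G.dim} (hw : w ∈ G.guide) :
    h.shift w = w := by
  rw [shift_apply, reflection, reflection, h.mirror_guide hw]
  simp [h.guide_right w hw]

theorem shift_left (h : G.Geometry s C b) :
    h.shift (G.normal G.left) = -G.normal G.right := by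
  rw [shift_apply, h.mirror_left, reflection, h.norm]
  module

theorem isTile_shift_zpow (h : G.Geometry s C b) (k : ℤ) :
    IsTile G (⇑(h.shift ^ k) '' Set.range G.normal) := by
  have hr : ∀ {T}, IsTile G T → IsTile G (reflection (G.normal G.right) '' T) :=
    isTile_image (h.norm _) (IsTile.central.reflect ⟨_, rfl⟩)
  have hb : ∀ {T}, IsTile G T → IsTile G (reflection b '' T) :=
    isTile_image h.mirror_norm (by rw [h.mirror_image]; exact IsTile.central)
  induction k with
  | zero => simpa using IsTile.central
  | succ k ih =>
    have := hr (hb ih)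
    rw [add_comm (k : ℤ) 1, zpow_add, zpow_one]
    rw [Set.image_image, Set.image_image] at this
    exact this
  | pred k ih =>
    have := hb (hr ih)
    rw [show -(k : ℤ) - 1 = -1 + -k by ring, zpow_add, zpow_neg_one]
    rw [Set.image_image, Set.image_image] at this
    simp only [← h.shift_inv_apply] at this
    exact this

theorem nonempty_line (h : G.Geometry s C b) : Nonempty (Line G) :=
  ⟨{ tile := fun k => ⟨_, h.isTile_shift_zpow k⟩
     place := fun k => ⟨h.shift ^ k, zpow_mem h.shift_mem k, rfl⟩
     guide_eq := fun k w hw => by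
      change (h.shift ^ (k + 1)) w = (h.shift ^ k) w
      rw [zpow_add, zpow_one, LinearEquiv.mul_apply, h.shift_guide hw]
     left_eq := fun k => by
      change (h.shift ^ (k + 1)) _ = -(h.shift ^ k) _
      rw [zpow_add, zpow_one, LinearEquiv.mul_apply, h.shift_left, map_neg] }⟩

end Grid.Geometry

/-! ### Rotations of the central tile and centres of tiles -/

/-- The permutations of the faces of the central tile which are induced by the positive motions
leaving this tile globally invariant. -/
def Grid.rotations (G : Grid) : Subgroup (Equiv.Perm (Fin G.faces)) where
  carrier := {μ | ∃ g ∈ positiveMotions G.dim, ∀ i, g (G.normal i) = G.normal (μ i)}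
  mul_mem' := by
    rintro μ μ' ⟨g, hg, h⟩ ⟨g', hg', h'⟩
    exact ⟨g * g', mul_mem hg hg', fun i => by
      rw [LinearEquiv.mul_apply, h', h, Equiv.Perm.mul_apply]⟩
  one_mem' := ⟨1, one_mem _, fun _ => rfl⟩
  inv_mem' := by
    rintro μ ⟨g, hg, h⟩
    refine ⟨g⁻¹, inv_mem hg, fun i => ?_⟩
    have hi : μ (μ⁻¹ i) = i := μ.apply_symm_apply i
    conv_lhs => rw [← hi, ← h]
    exact g.symm_apply_apply _

/-- The sum of the outward unit normals of a tile, which is proportional to its centre. -/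
def Tile.centre {G : Grid} (T : Tile G) : Mink G.dim := ∑ᶠ v ∈ T.1, v

/-- Two numberings of the same tile differ by a rotation of the central tile. This is the only way
in which the arbitrary numbering enters the simulation. -/
theorem exists_rotation {G : Grid} (hinj : Function.Injective G.normal) {T : Tile G}
    (P P' : Placement T) :
    ∃ μ ∈ G.rotations, ∀ i, P'.motion (G.normal i) = P.motion (G.normal (μ i)) := by
  have h1 : ∀ i, ∃ j, P'.motion (G.normal i) = P.motion (G.normal j) := by
    intro i
    have : P'.motion (G.normal i) ∈ P.motion '' Set.range G.normal := by
      rw [P.image_eq, ← P'.image_eq]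
      exact ⟨_, ⟨i, rfl⟩, rfl⟩
    obtain ⟨_, ⟨j, rfl⟩, hj⟩ := this
    exact ⟨j, hj.symm⟩
  choose μ hμ using h1
  have hμi : Function.Injective μ := by
    intro i j hij
    apply hinj
    apply P'.motion.injective
    rw [hμ, hμ, hij]
  refine ⟨Equiv.ofBijective μ (Finite.injective_iff_bijective.mp hμi),
    ⟨P.motion⁻¹ * P'.motion, mul_mem (inv_mem P.motion_mem) P'.motion_mem, fun i => ?_⟩, hμ⟩
  rw [LinearEquiv.mul_apply, hμ]
  exact P.motion.symm_apply_apply _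

namespace Grid.Geometry

variable {G : Grid} {s C : ℝ} {b : Mink G.dim}

theorem map_origin_of_rotation (h : G.Geometry s C b) {g : Mink G.dim ≃ₗ[ℝ] Mink G.dim}
    {μ : Equiv.Perm (Fin G.faces)} (hg : ∀ i, g (G.normal i) = G.normal (μ i)) :
    g (origin G.dim) = origin G.dim := by
  obtain ⟨κ, hκ, hs⟩ := h.sum
  have : g (κ • origin G.dim) = κ • origin G.dim := by
    rw [← hs, map_sum]
    simp only [hg]
    exact Equiv.sum_comp μ G.normal
  rw [map_smul] at this
  exact smul_right_injective _ hκ this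

theorem rotation_mink {μ : Equiv.Perm (Fin G.faces)}
    (hμ : μ ∈ G.rotations) (i j : Fin G.faces) :
    mink (G.normal (μ i)) (G.normal (μ j)) = mink (G.normal i) (G.normal j) := by
  obtain ⟨g, hg, hgμ⟩ := hμ
  rw [← hgμ, ← hgμ, hg.1]

theorem finsum_image (h : G.Geometry s C b) {f : Mink G.dim → Mink G.dim}
    (hf : Function.Injective f) :
    ∑ᶠ v ∈ f '' Set.range G.normal, v = ∑ i, f (G.normal i) := by
  rw [← Set.range_comp, finsum_mem_range (hf.comp h.injective), finsum_eq_sum_of_fintype]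
  rfl

/-- A tile is only a set of normals, so an equality of tiles gives no equality of motions. Summing
the normals yields an invariant free of the placement; for a neighbour, it is the mirror image of
the centre, at height `s` below the face. -/
theorem centre_eq (h : G.Geometry s C b) : ∃ κ : ℝ, κ ≠ 0 ∧
    (∀ (T : Tile G) (P : Placement T), T.centre = κ • P.motion (origin G.dim)) ∧
    ∀ (T : Tile G) (P : Placement T) (i : Fin G.faces), (P.neighbour i).centre =
      κ • (P.motion (origin G.dim) + (2 * s) • P.motion (G.normal i)) := by
  obtain ⟨κ, hκ, hs⟩ := h.sum
  refine ⟨κ, hκ, fun T P => ?_, fun T P i => ?_⟩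
  · rw [Tile.centre, ← P.image_eq, h.finsum_image P.motion.injective, ← map_smul, ← hs, map_sum]
  · have hn : mink (P.motion (G.normal i)) (P.motion (G.normal i)) = 1 := by
      rw [P.motion_mem.1, h.norm]
    have : (P.neighbour i).1 = (reflectionEquiv _ hn * P.motion) '' Set.range G.normal := by
      change reflection _ '' T.1 = _
      rw [← P.image_eq, Set.image_image]
      rfl
    rw [Tile.centre, this, h.finsum_image (LinearEquiv.injective _), ← map_sum, hs, map_smul,
      LinearEquiv.mul_apply, reflectionEquiv_apply, reflection, P.motion_mem.1, h.height]
    congr 1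
    module

theorem motion_origin_eq (h : G.Geometry s C b) {T T' : Tile G} (hT : T = T') (P : Placement T)
    (P' : Placement T') : P.motion (origin G.dim) = P'.motion (origin G.dim) := by
  subst hT
  obtain ⟨κ, hκ, h1, -⟩ := h.centre_eq
  exact smul_right_injective _ hκ ((h1 T P).symm.trans (h1 T P'))

theorem origin_add_eq_of_neighbour (h : G.Geometry s C b) {T T' : Tile G} {P : Placement T}
    {P' : Placement T'} {i : Fin G.faces} (hi : P.neighbour i = T') :
    P.motion (origin G.dim) + (2 * s) • P.motion (G.normal i) = P'.motion (origin G.dim) := by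
  obtain ⟨κ, hκ, h1, h2⟩ := h.centre_eq
  have := h2 T P i
  rw [hi, h1 T' P'] at this
  exact smul_right_injective _ hκ this.symm

theorem origin_add_eq_of_neighbours (h : G.Geometry s C b) {T T' : Tile G} {P : Placement T}
    {P' : Placement T'} {i j : Fin G.faces} (hi : P.neighbour i = P'.neighbour j) :
    P.motion (origin G.dim) + (2 * s) • P.motion (G.normal i) =
      P'.motion (origin G.dim) + (2 * s) • P'.motion (G.normal j) := by
  obtain ⟨κ, hκ, h1, h2⟩ := h.centre_eq
  have := h2 T P i
  rw [hi, h2 T' P'] at this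
  exact smul_right_injective _ hκ this.symm

theorem neighbour_injective (h : G.Geometry s C b) {T : Tile G} (P : Placement T) :
    Function.Injective P.neighbour := by
  intro i j hij
  have := add_left_cancel (h.origin_add_eq_of_neighbours hij)
  have h2 : (2 * s) ≠ 0 := by linarith [h.s_pos]
  exact h.injective (P.motion.injective (smul_right_injective _ h2 this))

theorem mink_origin_add (h : G.Geometry s C b) {T : Tile G} (P : Placement T) (i : Fin G.faces) :
    mink (P.motion (origin G.dim))
      (P.motion (origin G.dim) + (2 * s) • P.motion (G.normal i)) = -1 - 2 * s ^ 2 := by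
  rw [← map_smul, ← map_add, P.motion_mem.1, mink_add_right, mink_smul_right, h.height,
    origin_mem_hypSpace.1]
  ring

end Grid.Geometry

/-! ### Two-sided sequences with the recurrence of the hyperbolic cosine -/

theorem int_two_step_induction {p : ℤ → Prop} (h0 : p 0) (h1 : p 1)
    (hs : ∀ k, p k → p (k + 1) → p (k + 2)) (hp : ∀ k, p (k + 1) → p (k + 2) → p k) (k : ℤ) :
    p k := by
  have : p k ∧ p (k + 1) := by
    induction k with
    | zero => exact ⟨h0, by simpa using h1⟩
    | succ k ih =>
      refine ⟨ih.2, ?_⟩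
      have := hs _ ih.1 ih.2
      rwa [show (k : ℤ) + 1 + 1 = k + 2 by ring]
    | pred k ih =>
      rw [show -(k : ℤ) - 1 + 1 = -k by ring]
      refine ⟨hp _ ?_ ?_, ih.1⟩
      · rw [show -(k : ℤ) - 1 + 1 = -k by ring]; exact ih.1
      · rw [show -(k : ℤ) - 1 + 2 = -k + 1 by ring]; exact ih.2
  exact this.1

/-- A sequence with the recurrence relation of `cosh (k * L)` and the same two first values. -/
theorem eq_cosh_of_recurrence {a : ℤ → ℝ} {L : ℝ} (h0 : a 0 = 1) (h1 : a 1 = Real.cosh L)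
    (hr : ∀ k, a (k + 2) = 2 * Real.cosh L * a (k + 1) - a k) (k : ℤ) :
    a k = Real.cosh (k * L) := by
  have key : ∀ k : ℤ, Real.cosh (((k + 2 : ℤ) : ℝ) * L) =
      2 * Real.cosh L * Real.cosh (((k + 1 : ℤ) : ℝ) * L) - Real.cosh (k * L) := by
    intro k
    have e1 : ((k + 2 : ℤ) : ℝ) * L = ((k + 1 : ℤ) : ℝ) * L + L := by push_cast; ring
    have e2 : (k : ℝ) * L = ((k + 1 : ℤ) : ℝ) * L - L := by push_cast; ring
    rw [e1, e2, Real.cosh_add, Real.cosh_sub]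
    ring
  refine int_two_step_induction (p := fun k : ℤ => a k = Real.cosh (k * L)) (by simpa using h0)
    (by simpa using h1) (fun k h2 h3 => ?_) (fun k h2 h3 => ?_) k
  · rw [hr, key, h2, h3]
  · have := hr k
    have := key k
    rw [h2, h3] at *
    linarith

theorem cosh_int_mul_le {L : ℝ} (hL : 0 < L) {i j : ℤ} (h : |i| ≤ |j|) :
    Real.cosh (i * L) ≤ Real.cosh (j * L) := by
  rw [Real.cosh_le_cosh, abs_mul, abs_mul]
  have : ((|i| : ℤ) : ℝ) ≤ ((|j| : ℤ) : ℝ) := by exact_mod_cast h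
  push_cast at this
  gcongr

theorem cosh_int_mul_eq {L : ℝ} (hL : 0 < L) {i j : ℤ}
    (h : Real.cosh (i * L) = Real.cosh (j * L)) : |i| = |j| := by
  have h1 := (Real.cosh_le_cosh.mp h.le).antisymm (Real.cosh_le_cosh.mp h.ge)
  rw [abs_mul, abs_mul] at h1
  have := mul_right_cancel₀ (abs_pos.mpr hL.ne').ne' h1
  exact_mod_cast this

/-! ### Walls, axis and centres of the cells of a line -/

namespace Line

variable {G : Grid}

/-- The outward unit normal of the right-hand face of a cell of the line. -/
def wall (ℓ : Line G) (k : ℤ) : Mink G.dim := (ℓ.place k).motion (G.normal G.right)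

/-- The centre of a cell of the line. -/
def centre (ℓ : Line G) (k : ℤ) : Mink G.dim := (ℓ.place k).motion (origin G.dim)

theorem left_eq_neg_wall (ℓ : Line G) (k : ℤ) :
    (ℓ.place k).motion (G.normal G.left) = -ℓ.wall (k - 1) := by
  have := ℓ.left_eq (k - 1)
  rwa [sub_add_cancel] at this

theorem eq_on_span_guide (ℓ : Line G) {w : Mink G.dim} (hw : w ∈ Submodule.span ℝ G.guide)
    (i j : ℤ) : (ℓ.place i).motion w = (ℓ.place j).motion w := by
  have key : ∀ i, ∀ w ∈ G.guide, (ℓ.place i).motion w = (ℓ.place 0).motion w := by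
    intro i w hw
    induction i with
    | zero => rfl
    | succ k ih => rw [ℓ.guide_eq k w hw, ih]
    | pred k ih =>
      have := ℓ.guide_eq (-k - 1) w hw
      rw [sub_add_cancel] at this
      rw [← this, ih]
  induction hw using Submodule.span_induction with
  | mem w hw => rw [key i w hw, key j w hw]
  | zero => simp
  | add x y _ _ hx hy => rw [map_add, map_add, hx, hy]
  | smul a x _ hx => rw [map_smul, map_smul, hx]

end Line

namespace Grid.Geometry

variable {G : Grid} {s C : ℝ} {b : Mink G.dim} (h : G.Geometry s C b) (ℓ : Line G)
include h

theorem mink_wall_self (k : ℤ) : mink (ℓ.wall k) (ℓ.wall k) = 1 := by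
  rw [Line.wall, (ℓ.place k).motion_mem.1, h.norm]

theorem mink_wall_pred (k : ℤ) : mink (ℓ.wall (k - 1)) (ℓ.wall k) = C := by
  have := (ℓ.place k).motion_mem.1 (G.normal G.left) (G.normal G.right)
  rw [ℓ.left_eq_neg_wall, h.left_right, mink_neg_left] at this
  rw [Line.wall, Line.wall] at *
  linarith

theorem guide_orthogonal_of_mem_span {w : Mink G.dim} (hw : w ∈ Submodule.span ℝ G.guide) :
    mink w (G.normal G.left) = 0 ∧ mink w (G.normal G.right) = 0 := by
  induction hw using Submodule.span_induction with
  | mem w hw => exact ⟨h.guide_left w hw, h.guide_right w hw⟩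
  | zero => simp [mink_zero_left]
  | add x y _ _ hx hy => simp [mink_add_left, hx, hy]
  | smul a x _ hx => simp [mink_smul_left, hx]

/-- Seen from cell `k`, the next wall is orthogonal to the guide, hence a combination `α l + β r` of
the left and right normals. Its square and its product with the shared wall leave only `α = 1` and
`α = -1`; the second would put the centre of the next cell on the lower sheet. -/
theorem wall_recurrence (k : ℤ) : ℓ.wall (k + 1) = (2 * C) • ℓ.wall k - ℓ.wall (k - 1) := by
  set P := (ℓ.place k).motion
  set P' := (ℓ.place (k + 1)).motion
  have hP := (ℓ.place k).motion_mem
  have hP' := (ℓ.place (k + 1)).motion_mem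
  set z := P⁻¹ (P' (G.normal G.right)) with hz
  have hPz : P z = P' (G.normal G.right) := P.apply_symm_apply _
  have hl : P' (G.normal G.left) = -P (G.normal G.right) := ℓ.left_eq k
  have hmz : ∀ y, mink z y = mink (P' (G.normal G.right)) (P y) := fun y => by
    rw [← hPz, hP.1]
  obtain ⟨α, β, hab⟩ := h.span z fun w hw => by
    rw [mink_comm, hmz, ← ℓ.guide_eq k w hw, hP'.1, mink_comm, h.guide_right w hw]
  have hrl := h.left_right
  have hlr := hrl
  rw [mink_comm] at hlr
  have e1 : mink z (G.normal G.right) = C := by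
    rw [hmz, ← neg_neg (P (G.normal G.right)), ← hl, mink_neg_right, hP'.1, hlr, neg_neg]
  have e2 : mink z z = 1 := by
    rw [hmz, hPz, hP'.1, h.norm]
  rw [hab] at e1 e2
  simp only [mink_add_left, mink_add_right, mink_smul_left, mink_smul_right, h.norm, hrl, hlr]
    at e1 e2
  have hC := h.one_lt
  have hs := h.s_pos
  have hβ : β = C * (α + 1) := by linarith
  have hα : (α - 1) * (α + 1) = 0 := by
    have : (α - 1) * (α + 1) * (C ^ 2 - 1) = 0 := by
      rw [hβ] at e2
      linear_combination -e2
    rcases mul_eq_zero.mp this with h0 | h0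
    · exact h0
    · nlinarith
  have hα1 : α = 1 := by
    rcases mul_eq_zero.mp hα with h0 | h0
    · linarith
    · exfalso
      -- In this case the next motion sends `l`, `r` to minus the images of `r`, `l` while keeping
      -- the guide component `w` of the centre. The two centres then have product `-1 + 4 s² / (C -
      -- 1)`, which is at least `1` by `le_two_sq`, whereas points of the same sheet have negative
      -- product.
      have hα' : α = -1 := by linarith
      have hβ0 : β = 0 := by rw [hβ, hα']; ring
      set w := origin G.dim - (s / (C - 1)) • (G.normal G.left + G.normal G.right) with hw
      have hwm := h.origin_mem
      rw [← hw] at hwm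
      have ho : origin G.dim = (s / (C - 1)) • (G.normal G.left + G.normal G.right) + w := by
        rw [hw]; module
      have hR : P' (G.normal G.right) = -P (G.normal G.left) := by
        rw [← hPz, hab, hα', hβ0]
        simp
      have h1 : P' (origin G.dim)
          = P (origin G.dim - (2 * (s / (C - 1))) • (G.normal G.left + G.normal G.right)) := by
        conv_lhs => rw [ho]
        conv_rhs => rw [ho]
        simp only [map_add, map_sub, map_smul, hl, hR]
        rw [ℓ.eq_on_span_guide hwm (k + 1) k]
        module
      have h2 := mink_neg_of_mem_hypSpace ((hP.2.1 _).mpr origin_mem_hypSpace)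
        ((hP'.2.1 _).mpr origin_mem_hypSpace)
      rw [h1, hP.1, mink_sub_right, mink_smul_right, mink_add_right, h.height, h.height,
        origin_mem_hypSpace.1] at h2
      have h3 : s / (C - 1) * (C - 1) = s := div_mul_cancel₀ _ (by linarith)
      have h4 : 0 < s / (C - 1) := div_pos hs (by linarith)
      have h5 := h.le_two_sq
      have h6 : s * s = s / (C - 1) * s * (C - 1) := by linear_combination (-s) * h3
      nlinarith
  have : ℓ.wall (k + 1) = P z := hPz.symm
  rw [this, hab, hβ, hα1, map_add, map_smul, map_smul, ℓ.left_eq_neg_wall]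
  change _ + _ • ℓ.wall k = _
  module

theorem exists_length : ∃ L : ℝ, 0 < L ∧ Real.cosh L = C ∧
    ∀ i j, mink (ℓ.wall i) (ℓ.wall j) = Real.cosh ((j - i : ℤ) * L) := by
  refine ⟨Real.arcosh C, Real.arcosh_pos h.one_lt, Real.cosh_arcosh h.one_lt.le, fun i j => ?_⟩
  have hC := Real.cosh_arcosh h.one_lt.le
  have := eq_cosh_of_recurrence (a := fun m => mink (ℓ.wall i) (ℓ.wall (i + m)))
    (L := Real.arcosh C) (by simpa using h.mink_wall_self ℓ i)
    (by
      rw [hC]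
      have := h.mink_wall_pred ℓ (i + 1)
      rwa [add_sub_cancel_right] at this)
    (fun m => by
      have := h.wall_recurrence ℓ (i + (m + 1))
      rw [show i + (m + 1) + 1 = i + (m + 2) by ring, show i + (m + 1) - 1 = i + m by ring] at this
      simp only [this, mink_sub_right, mink_smul_right, hC])
    (j - i)
  simpa using this

/-- The centre splits into its projection to the plane of the two walls and a component `w` in the
span of the guide. All placements act alike on that span, so `w` does not depend on the cell. -/
theorem exists_axis : ∃ w : Mink G.dim, (∀ k, mink w (ℓ.wall k) = 0) ∧
    mink w w = 2 * s ^ 2 / (C - 1) - 1 ∧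
    ∀ k, ℓ.centre k = (s / (C - 1)) • (ℓ.wall k - ℓ.wall (k - 1)) + w := by
  set w := origin G.dim - (s / (C - 1)) • (G.normal G.left + G.normal G.right) with hw
  have hwm := h.origin_mem
  rw [← hw] at hwm
  refine ⟨(ℓ.place 0).motion w, fun k => ?_, ?_, fun k => ?_⟩
  · rw [ℓ.eq_on_span_guide hwm 0 k, Line.wall, (ℓ.place k).motion_mem.1,
      (h.guide_orthogonal_of_mem_span hwm).2]
  · have hlr := h.left_right
    rw [mink_comm] at hlr
    have h3 : s / (C - 1) * (C - 1) = s := div_mul_cancel₀ _ (by linarith [h.one_lt])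
    have h4 : 2 * s ^ 2 / (C - 1) = 2 * s * (s / (C - 1)) := by ring
    rw [(ℓ.place 0).motion_mem.1, hw, h4]
    simp only [mink_sub_left, mink_sub_right, mink_smul_left, mink_smul_right, mink_add_left,
      mink_add_right, h.norm, h.left_right, hlr, origin_mem_hypSpace.1, h.height,
      mink_comm _ (origin _)]
    linear_combination (-2 * (s / (C - 1))) * h3
  · rw [ℓ.eq_on_span_guide hwm 0 k, hw, map_sub, map_smul, map_add, ℓ.left_eq_neg_wall]
    simp only [Line.wall, Line.centre]
    module

theorem exists_mink_centre : ∃ L : ℝ, 0 < L ∧ Real.cosh L = C ∧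
    ∀ i j, mink (ℓ.centre i) (ℓ.centre j) =
      -1 - 2 * s ^ 2 / (C - 1) * (Real.cosh ((j - i : ℤ) * L) - 1) := by
  obtain ⟨L, hL, hC, hw⟩ := h.exists_length ℓ
  obtain ⟨w, hw0, hw1, hw2⟩ := h.exists_axis ℓ
  refine ⟨L, hL, hC, fun i j => ?_⟩
  have hC1 : C - 1 ≠ 0 := by linarith [h.one_lt]
  simp only [hw2, mink_sub_left, mink_sub_right, mink_smul_left, mink_smul_right, mink_add_left,
    mink_add_right, hw0, mink_comm _ w, hw1, hw]
  have e1 : ((j - 1 - i : ℤ) : ℝ) * L = ((j - i : ℤ) : ℝ) * L - L := by push_cast; ring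
  have e2 : ((j - (i - 1) : ℤ) : ℝ) * L = ((j - i : ℤ) : ℝ) * L + L := by push_cast; ring
  have e3 : ((j - 1 - (i - 1) : ℤ) : ℝ) * L = ((j - i : ℤ) : ℝ) * L := by push_cast; ring
  rw [e1, e2, e3, Real.cosh_add, Real.cosh_sub, hC]
  field_simp
  ring

theorem centre_injective {i j : ℤ} (hij : ℓ.centre i = ℓ.centre j) : i = j := by
  obtain ⟨L, hL, -, hm⟩ := h.exists_mink_centre ℓ
  have h1 := hm i j
  have h2 := hm i i
  rw [← hij, h2] at h1
  have h3 : 2 * s ^ 2 / (C - 1) ≠ 0 :=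
    div_ne_zero (by have := h.s_pos; positivity) (by linarith [h.one_lt])
  have h4 := mul_left_cancel₀ h3 (sub_right_injective h1)
  have := cosh_int_mul_eq hL (sub_left_injective h4)
  simp only [sub_self, abs_zero] at this
  have := abs_eq_zero.mp this.symm
  omega

theorem adjacent_of_mink_centre {i j : ℤ}
    (hij : mink (ℓ.centre i) (ℓ.centre j) = -1 - 2 * s ^ 2) : j = i + 1 ∨ j = i - 1 := by
  obtain ⟨L, hL, hC, hm⟩ := h.exists_mink_centre ℓ
  rw [hm] at hij
  have hC1 : C - 1 ≠ 0 := by linarith [h.one_lt]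
  have hs : s ≠ 0 := h.s_pos.ne'
  have h2 : Real.cosh ((j - i : ℤ) * L) = Real.cosh ((1 : ℤ) * L) := by
    rw [Int.cast_one, one_mul, hC]
    field_simp at hij
    have h3 : s ^ 2 * (Real.cosh ((j - i : ℤ) * L) - C) = 0 := by linear_combination (-1 / 2) * hij
    rcases mul_eq_zero.mp h3 with h4 | h4
    · exact absurd h4 (pow_ne_zero 2 hs)
    · linarith
  have := cosh_int_mul_eq hL h2
  rw [abs_one] at this
  rcases abs_eq (by norm_num : (0:ℤ) ≤ 1) |>.mp this with h3 | h3 <;> omega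

theorem tile_injective : Function.Injective ℓ.tile := fun i j hij =>
  h.centre_injective ℓ (h.motion_origin_eq hij (ℓ.place i) (ℓ.place j))

/-! ### Consecutive placements and adjacency along a line -/

omit ℓ in
theorem eq_zero_of_orthogonal {v : Mink G.dim} (hg : ∀ w ∈ G.guide, mink w v = 0)
    (hl : mink v (G.normal G.left) = 0) (hr : mink v (G.normal G.right) = 0) : v = 0 := by
  obtain ⟨α, β, rfl⟩ := h.span v hg
  have hlr := h.left_right
  rw [mink_comm] at hlr
  simp only [mink_add_left, mink_smul_left, h.norm, h.left_right, hlr] at hl hr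
  have hC := h.one_lt
  have hα : α * (C ^ 2 - 1) = 0 := by linear_combination (-1) * hl - C * hr
  have hα0 : α = 0 := (mul_eq_zero.mp hα).resolve_right (by nlinarith)
  have hβ0 : β = 0 := by rw [hα0] at hr; linarith
  simp [hα0, hβ0]

/-- The two motions agree on the guide and on the left and right normals. Both preserve the form,
and no non-zero vector is orthogonal to all of these, so they agree everywhere. -/
theorem motion_succ (k : ℤ) :
    (ℓ.place (k + 1)).motion = (ℓ.place k).motion * h.shift := by
  set P := (ℓ.place k).motion
  set P' := (ℓ.place (k + 1)).motion
  have hP' := (ℓ.place (k + 1)).motion_mem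
  have hQ : P * h.shift ∈ positiveMotions G.dim := mul_mem (ℓ.place k).motion_mem h.shift_mem
  have hg : ∀ w ∈ G.guide, (P * h.shift) w = P' w := fun w hw => by
    rw [LinearEquiv.mul_apply, h.shift_guide hw]
    exact (ℓ.guide_eq k w hw).symm
  have hl : (P * h.shift) (G.normal G.left) = P' (G.normal G.left) := by
    rw [LinearEquiv.mul_apply, h.shift_left, map_neg]
    exact (ℓ.left_eq k).symm
  have hr : (P * h.shift) (G.normal G.right) = P' (G.normal G.right) := by
    have h1 : reflection b (G.normal G.right) = G.normal G.left := by
      rw [← h.mirror_left, reflection_reflection h.mirror_norm]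
    have h2 : P' (G.normal G.right) = (2 * C) • P (G.normal G.right) - ℓ.wall (k - 1) :=
      h.wall_recurrence ℓ k
    have h3 : P (G.normal G.left) = -ℓ.wall (k - 1) := ℓ.left_eq_neg_wall k
    rw [LinearEquiv.mul_apply, h.shift_apply, h1, reflection, h.left_right, h2, map_sub, map_smul,
      h3]
    module
  have key : ∀ x y, (P * h.shift) x = P' x → mink y x = mink (P'⁻¹ ((P * h.shift) y)) x := by
    intro x y hxy
    rw [map_symm_eq hP', ← hxy, hQ.1]
  refine LinearEquiv.ext fun y => ?_
  have : y - P'⁻¹ ((P * h.shift) y) = 0 := by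
    refine h.eq_zero_of_orthogonal (fun w hw => ?_) ?_ ?_
    · rw [mink_comm, mink_sub_left, ← key w y (hg w hw), sub_self]
    · rw [mink_sub_left, ← key _ y hl, sub_self]
    · rw [mink_sub_left, ← key _ y hr, sub_self]
  conv_lhs => rw [sub_eq_zero.mp this]
  exact P'.apply_symm_apply _

theorem neighbour_right (k : ℤ) : (ℓ.place k).neighbour G.right = ℓ.tile (k + 1) := by
  apply Subtype.ext
  change reflection ((ℓ.place k).motion (G.normal G.right)) '' (ℓ.tile k).1 = _
  rw [← (ℓ.place k).image_eq, ← (ℓ.place (k + 1)).image_eq, h.motion_succ ℓ k]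
  conv_lhs => rw [← h.mirror_image]
  simp only [Set.image_image, LinearEquiv.mul_apply, h.shift_apply]
  exact Set.image_congr fun x _ => reflection_map (ℓ.place k).motion_mem.1 _ _

theorem neighbour_left (k : ℤ) : (ℓ.place k).neighbour G.left = ℓ.tile (k - 1) := by
  apply Subtype.ext
  change reflection ((ℓ.place k).motion (G.normal G.left)) '' (ℓ.tile k).1 = _
  have h1 := h.neighbour_right ℓ (k - 1)
  rw [sub_add_cancel] at h1
  rw [ℓ.left_eq_neg_wall, ← h1]
  change _ '' (reflection (ℓ.wall (k - 1)) '' (ℓ.tile (k - 1)).1) = _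
  rw [Set.image_image]
  have h2 : ∀ x, reflection (-ℓ.wall (k - 1)) x = reflection (ℓ.wall (k - 1)) x := fun x => by
    simp [reflection, mink_neg_right]
  simp only [h2, reflection_reflection (h.mink_wall_self ℓ _), Set.image_id']

/-- The cells of the line which a cell of the line sees are its left-hand and right-hand
neighbours. -/
theorem neighbour_eq_tile {i : Fin G.faces} {j k : ℤ} (hij : (ℓ.place k).neighbour i = ℓ.tile j) :
    i = G.left ∧ j = k - 1 ∨ i = G.right ∧ j = k + 1 := by
  have h1 := h.origin_add_eq_of_neighbour (P' := ℓ.place j) hij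
  -- The centres of adjacent tiles have product `-1 - 2 s²`, which along the line happens only at
  -- index distance one.
  have h2 : mink (ℓ.centre k) (ℓ.centre j) = -1 - 2 * s ^ 2 := by
    rw [← h.mink_origin_add (ℓ.place k) i, h1]
    rfl
  rcases h.adjacent_of_mink_centre ℓ h2 with rfl | rfl
  · exact Or.inr ⟨h.neighbour_injective (ℓ.place k) (hij.trans (h.neighbour_right ℓ k).symm), rfl⟩
  · exact Or.inl ⟨h.neighbour_injective (ℓ.place k) (hij.trans (h.neighbour_left ℓ k).symm), rfl⟩

end Grid.Geometry

/-! ### Regular polygons -/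

theorem exp_pow_eq (p j : ℕ) : Complex.exp (2 * Real.pi * Complex.I / p) ^ j =
    (Real.cos (2 * Real.pi * j / p) : ℂ) + Real.sin (2 * Real.pi * j / p) * Complex.I := by
  rw [← Complex.exp_nat_mul, Complex.ofReal_cos, Complex.ofReal_sin, ← Complex.exp_mul_I]
  congr 1
  push_cast
  ring

/-- Real and imaginary parts of the vanishing sum of all `p`-th roots of unity. -/
theorem sum_cos_sin_eq_zero {p : ℕ} (hp : 1 < p) :
    ∑ i : Fin p, Real.cos (2 * Real.pi * (i : ℕ) / p) = 0 ∧
      ∑ i : Fin p, Real.sin (2 * Real.pi * (i : ℕ) / p) = 0 := by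
  have h := (Complex.isPrimitiveRoot_exp p (by omega)).geom_sum_eq_zero hp
  simp only [exp_pow_eq, ← Fin.sum_univ_eq_sum_range (fun j => (Real.cos (2 * Real.pi * j / p) : ℂ)
    + Real.sin (2 * Real.pi * j / p) * Complex.I) p] at h
  rw [sum_add_distrib, ← sum_mul, ← Complex.ofReal_sum, ← Complex.ofReal_sum] at h
  constructor
  · have := congrArg Complex.re h
    rwa [Complex.add_re, Complex.re_ofReal_mul, Complex.I_re, mul_zero, add_zero,
      Complex.ofReal_re, Complex.zero_re] at this
  · have := congrArg Complex.im h
    rwa [Complex.add_im, Complex.im_ofReal_mul, Complex.I_im, mul_one, Complex.ofReal_im,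
      zero_add, Complex.zero_im] at this

theorem eq_of_cos_eq_of_sin_eq {p : ℕ} {i j : Fin p}
    (hc : Real.cos (2 * Real.pi * (i : ℕ) / p) = Real.cos (2 * Real.pi * (j : ℕ) / p))
    (hs : Real.sin (2 * Real.pi * (i : ℕ) / p) = Real.sin (2 * Real.pi * (j : ℕ) / p)) : i = j := by
  have hp : p ≠ 0 := by have := i.2; omega
  apply Fin.ext
  refine (Complex.isPrimitiveRoot_exp p hp).pow_inj i.2 j.2 ?_
  rw [exp_pow_eq, exp_pow_eq, hc, hs]

theorem polygonSinh_sq {p q : ℕ} (h : 1 < polygonCosh p q) :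
    polygonSinh p q ^ 2 = polygonCosh p q ^ 2 - 1 :=
  Real.sq_sqrt (by nlinarith)

theorem polygonSinh_pos {p q : ℕ} (h : 1 < polygonCosh p q) : 0 < polygonSinh p q :=
  Real.sqrt_pos.mpr (by nlinarith)

theorem mink_vec3 (a b c a' b' c' : ℝ) :
    mink (d := 2) ![a, b, c] ![a', b', c'] = -(a * a') + (b * b' + c * c') := by
  simp [mink, Fin.sum_univ_two]

theorem mink_two_ext {x y : Mink 2} (h0 : x 0 = y 0) (h1 : x 1 = y 1) (h2 : x 2 = y 2) :
    x = y := by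
  ext i
  fin_cases i
  exacts [h0, h1, h2]

theorem origin_two : origin 2 = ![1, 0, 0] := by
  ext i
  fin_cases i <;> simp [origin]

theorem mink_polygonNormal {p q : ℕ} (h : 1 < polygonCosh p q) (i : Fin p) :
    mink (polygonNormal p q i) (polygonNormal p q i) = 1 := by
  rw [polygonNormal, mink_vec3]
  linear_combination (-1) * polygonSinh_sq h +
    polygonCosh p q ^ 2 * Real.cos_sq_add_sin_sq (2 * Real.pi * (i : ℕ) / p)

theorem mink_origin_polygonNormal (p q : ℕ) (i : Fin p) :
    mink (origin 2) (polygonNormal p q i) = -polygonSinh p q := by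
  rw [origin_two, polygonNormal, mink_vec3]
  ring

theorem sum_polygonNormal {p : ℕ} (q : ℕ) (hp : 1 < p) :
    ∑ i, polygonNormal p q i = (p * polygonSinh p q) • origin 2 := by
  obtain ⟨h1, h2⟩ := sum_cos_sin_eq_zero hp
  rw [origin_two]
  ext k
  fin_cases k
  · simp [polygonNormal]
  · simp [polygonNormal, ← mul_sum, h1]
  · simp [polygonNormal, ← mul_sum, h2]

theorem polygonNormal_injective {p q : ℕ} (h : 1 < polygonCosh p q) :
    Function.Injective (polygonNormal p q) := by
  intro i j hij
  have h1 := congrFun hij 1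
  have h2 := congrFun hij 2
  simp only [polygonNormal, Matrix.cons_val] at h1 h2
  have hc : polygonCosh p q ≠ 0 := by linarith
  exact eq_of_cos_eq_of_sin_eq (mul_left_cancel₀ hc h1) (mul_left_cancel₀ hc (neg_injective h2))

/-- The mirror is the line through the centre at angle `ψ`. Sides are numbered clockwise, so their
angle is `-θ`, which explains the image angle `2ψ + θ`. -/
theorem reflection_vec3 (ψ r c θ : ℝ) :
    reflection (d := 2) ![0, -Real.sin ψ, Real.cos ψ] ![r, c * Real.cos θ, -(c * Real.sin θ)] =
      ![r, c * Real.cos (2 * ψ + θ), c * Real.sin (2 * ψ + θ)] := by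
  rw [reflection, mink_vec3, Real.cos_add, Real.sin_add, Real.cos_two_mul, Real.sin_two_mul]
  have := Real.sin_sq_add_cos_sq ψ
  ext k
  fin_cases k
  · simp
  · simp
    linear_combination (-2) * c * Real.cos θ * this
  · simp
    ring

/-! ### The pentagrid -/

theorem one_lt_polygonCosh_pentagrid : 1 < polygonCosh 5 4 := by
  have hpi := Real.pi_pos
  have h1 : Real.cos (Real.pi / (4 : ℕ)) = Real.sin (Real.pi / 4) := by
    rw [Nat.cast_ofNat, Real.cos_pi_div_four, Real.sin_pi_div_four]
  rw [polygonCosh, h1, one_lt_div]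
  · apply Real.sin_lt_sin_of_lt_of_le_pi_div_two <;> push_cast <;> linarith
  · apply Real.sin_pos_of_pos_of_lt_pi <;> push_cast <;> linarith

/-- This relation says that contiguous sides are orthogonal. -/
theorem pentagrid_relation :
    polygonSinh 5 4 ^ 2 = polygonCosh 5 4 ^ 2 * Real.cos (2 * Real.pi / 5) := by
  have hpi := Real.pi_pos
  have hs : 0 < Real.sin (Real.pi / 5) := Real.sin_pos_of_pos_of_lt_pi (by linarith) (by linarith)
  rw [polygonSinh_sq one_lt_polygonCosh_pentagrid, polygonCosh,
    show 2 * Real.pi / 5 = 2 * (Real.pi / 5) by ring, Real.cos_two_mul, Real.cos_sq']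
  push_cast
  rw [Real.cos_pi_div_four]
  field_simp
  rw [Real.sq_sqrt (by norm_num)]
  ring

theorem polygonNormal_pentagrid_four :
    polygonNormal 5 4 4 = ![polygonSinh 5 4, polygonCosh 5 4 * Real.cos (2 * Real.pi / 5),
      polygonCosh 5 4 * Real.sin (2 * Real.pi / 5)] := by
  have e : 2 * Real.pi * ((4 : Fin 5) : ℕ) / (5 : ℕ) = 2 * Real.pi - 2 * Real.pi / 5 := by
    simp; ring
  rw [polygonNormal, e, Real.cos_two_pi_sub, Real.sin_two_pi_sub]
  simp

theorem polygonNormal_pentagrid_one :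
    polygonNormal 5 4 1 = ![polygonSinh 5 4, polygonCosh 5 4 * Real.cos (2 * Real.pi / 5),
      -(polygonCosh 5 4 * Real.sin (2 * Real.pi / 5))] := by
  simp [polygonNormal]

theorem polygonNormal_pentagrid_zero :
    polygonNormal 5 4 0 = ![polygonSinh 5 4, polygonCosh 5 4, 0] := by
  simp [polygonNormal]

theorem geometry_pentagrid : ∃ C : ℝ,
    Grid.pentagrid.Geometry (polygonSinh 5 4) C ![0, -Real.sin 0, Real.cos 0] := by
  have hc := one_lt_polygonCosh_pentagrid
  have hs := polygonSinh_pos hc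
  have hcs := polygonSinh_sq hc
  have hrel := pentagrid_relation
  have hinj := polygonNormal_injective hc
  have hnorm := mink_polygonNormal hc
  have hheight := mink_origin_polygonNormal 5 4
  have hsum := sum_polygonNormal (p := 5) 4 (by norm_num)
  have n0 := polygonNormal_pentagrid_zero
  have n1 := polygonNormal_pentagrid_one
  have n4 := polygonNormal_pentagrid_four
  have hpi := Real.pi_pos
  have hσ : 0 < Real.sin (2 * Real.pi / 5) :=
    Real.sin_pos_of_pos_of_lt_pi (by linarith) (by linarith)
  have hσk := Real.sin_sq_add_cos_sq (2 * Real.pi / 5)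
  have hmir : ∀ i, ∃ j, reflection (d := 2) ![0, -Real.sin 0, Real.cos 0] (polygonNormal 5 4 i) =
      polygonNormal 5 4 j := by
    intro i
    have key : ∀ i j : Fin 5, ∀ m : ℕ, 2 * Real.pi * (i : ℕ) / (5 : ℕ)
        = m * (2 * Real.pi) - 2 * Real.pi * (j : ℕ) / (5 : ℕ) →
        reflection (d := 2) ![0, -Real.sin 0, Real.cos 0] (polygonNormal 5 4 i) =
          polygonNormal 5 4 j := by
      intro i j m hij
      rw [polygonNormal, reflection_vec3, mul_zero, zero_add, polygonNormal, hij,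
        Real.cos_nat_mul_two_pi_sub, Real.sin_nat_mul_two_pi_sub, mul_neg]
    fin_cases i
    · exact ⟨0, key 0 0 0 (by simp)⟩
    · exact ⟨4, key 1 4 1 (by simp; ring)⟩
    · exact ⟨3, key 2 3 1 (by simp; ring)⟩
    · exact ⟨2, key 3 2 1 (by simp; ring)⟩
    · exact ⟨1, key 4 1 1 (by simp; ring)⟩
  set s := polygonSinh 5 4
  set c := polygonCosh 5 4
  set k := Real.cos (2 * Real.pi / 5)
  set σ := Real.sin (2 * Real.pi / 5)
  have hk : c ^ 2 * (1 - k) = 1 := by linarith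
  have hk1 : 0 < 1 - k := by
    by_contra! h
    nlinarith [sq_nonneg c]
  have hk0 : 0 < k := by
    by_contra! h
    nlinarith [sq_nonneg c]
  have hC : mink (d := 2) (polygonNormal 5 4 1) (polygonNormal 5 4 4) =
      -(1 + 2 * s ^ 2 * (1 - k)) := by
    rw [n1, n4, mink_vec3]
    linear_combination (-c ^ 2) * hσk + hcs - 2 * k * hrel
  refine ⟨1 + 2 * s ^ 2 * (1 - k), hs, ?_, ?_, hnorm, hheight, ⟨_, ?_, hsum⟩, hinj, hC, ?_, ?_,
    ?_, ?_, ?_, ?_, hmir⟩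
  · have : 0 < s ^ 2 * (1 - k) := by positivity
    linarith
  · have : 0 < s ^ 2 * k := by positivity
    linarith
  · positivity
  · intro w hw
    rw [Set.mem_singleton_iff.mp hw]
    change mink (d := 2) (polygonNormal 5 4 0) (polygonNormal 5 4 1) = 0
    rw [n0, n1, mink_vec3]
    linear_combination (-1) * hrel
  · intro w hw
    rw [Set.mem_singleton_iff.mp hw]
    change mink (d := 2) (polygonNormal 5 4 0) (polygonNormal 5 4 4) = 0
    rw [n0, n4, mink_vec3]
    linear_combination (-1) * hrel
  · intro y hy
    have h0 := hy _ (Set.mem_singleton _)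
    rw [n0] at h0
    change ∃ α β : ℝ, y = α • polygonNormal 5 4 1 + β • polygonNormal 5 4 4
    have hy' : y = ![y 0, y 1, y 2] := mink_two_ext rfl rfl rfl
    rw [hy', mink_vec3] at h0
    -- The time coordinate gives `α + β` and the last coordinate gives `β - α`; the remaining
    -- coordinate follows from orthogonality to side `0`.
    refine ⟨(y 0 / s - y 2 / (c * σ)) / 2, (y 0 / s + y 2 / (c * σ)) / 2, ?_⟩
    rw [n1, n4]
    refine mink_two_ext ?_ ?_ ?_
    · simp; field_simp; ring
    · simp; field_simp
      apply mul_left_cancel₀ (show c ≠ 0 by positivity)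
      linear_combination 2 * σ * s * h0 + 2 * σ * y 0 * hrel
    · simp; field_simp; ring
  · change origin 2 - _ • (polygonNormal 5 4 1 + polygonNormal 5 4 4) ∈ _
    -- Side `0` has a unit normal whose product with the centre is `-s`, so this is the component of
    -- the centre along it.
    have : origin 2 - (s / (1 + 2 * s ^ 2 * (1 - k) - 1)) •
        (polygonNormal 5 4 1 + polygonNormal 5 4 4) = (-s) • polygonNormal 5 4 0 := by
      have hl : s / (1 + 2 * s ^ 2 * (1 - k) - 1) = c ^ 2 / (2 * s) := by
        rw [add_sub_cancel_left, div_eq_div_iff (by positivity) (by positivity)]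
        linear_combination (-2 * s ^ 2) * hk
      rw [hl, n0, n1, n4, origin_two]
      refine mink_two_ext ?_ ?_ ?_
      · simp; field_simp; linear_combination 2 * hcs
      · simp; field_simp; linear_combination (-2) * hrel
      · simp
    rw [this]
    exact Submodule.smul_mem _ _ (Submodule.subset_span rfl)
  · rw [mink_vec3]; simp
  · refine ⟨-1 / (2 * c * σ), ?_⟩
    change _ = _ • (polygonNormal 5 4 1 - polygonNormal 5 4 4)
    rw [n1, n4]
    refine mink_two_ext ?_ ?_ ?_
    · simp
    · simp
    · simp; field_simp; ring

/-! ### The heptagrid -/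

theorem one_lt_polygonCosh_heptagrid : 1 < polygonCosh 7 3 := by
  have hpi := Real.pi_pos
  have h1 : Real.cos (Real.pi / (3 : ℕ)) = Real.sin (Real.pi / 6) := by
    rw [Nat.cast_ofNat, Real.cos_pi_div_three, Real.sin_pi_div_six]
  rw [polygonCosh, h1, one_lt_div]
  · apply Real.sin_lt_sin_of_lt_of_le_pi_div_two <;> push_cast <;> linarith
  · apply Real.sin_pos_of_pos_of_lt_pi <;> push_cast <;> linarith

theorem four_mul_polygonCosh_heptagrid_sq :
    4 * polygonCosh 7 3 ^ 2 * Real.sin (Real.pi / 7) ^ 2 = 1 := by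
  have hpi := Real.pi_pos
  have hs : 0 < Real.sin (Real.pi / 7) := Real.sin_pos_of_pos_of_lt_pi (by linarith) (by linarith)
  rw [polygonCosh]
  push_cast
  rw [Real.cos_pi_div_three]
  field_simp
  norm_num

theorem polygonNormal_heptagrid_one :
    polygonNormal 7 3 1 = ![polygonSinh 7 3,
      polygonCosh 7 3 * (Real.cos (Real.pi / 7) * Real.cos (3 * (Real.pi / 7)) +
        Real.sin (Real.pi / 7) * Real.sin (3 * (Real.pi / 7))),
      polygonCosh 7 3 * (Real.sin (Real.pi / 7) * Real.cos (3 * (Real.pi / 7)) -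
        Real.cos (Real.pi / 7) * Real.sin (3 * (Real.pi / 7)))] := by
  have e : 2 * Real.pi * ((1 : Fin 7) : ℕ) / (7 : ℕ) = -(Real.pi / 7 - 3 * (Real.pi / 7)) := by
    simp; ring
  rw [polygonNormal, e, Real.cos_neg, Real.sin_neg, Real.cos_sub, Real.sin_sub, mul_neg, neg_neg]

theorem polygonNormal_heptagrid_five :
    polygonNormal 7 3 5 = ![polygonSinh 7 3,
      polygonCosh 7 3 * (Real.cos (Real.pi / 7) * Real.cos (3 * (Real.pi / 7)) -
        Real.sin (Real.pi / 7) * Real.sin (3 * (Real.pi / 7))),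
      polygonCosh 7 3 * (Real.sin (Real.pi / 7) * Real.cos (3 * (Real.pi / 7)) +
        Real.cos (Real.pi / 7) * Real.sin (3 * (Real.pi / 7)))] := by
  have e : 2 * Real.pi * ((5 : Fin 7) : ℕ) / (7 : ℕ) =
      2 * Real.pi - (Real.pi / 7 + 3 * (Real.pi / 7)) := by
    simp; ring
  rw [polygonNormal, e, Real.cos_two_pi_sub, Real.sin_two_pi_sub, Real.cos_add, Real.sin_add,
    mul_neg, neg_neg]

theorem polygonMidpoint_heptagrid_zero :
    polygonMidpoint 7 3 0 = ![polygonCosh 7 3, polygonSinh 7 3, 0] := by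
  simp [polygonMidpoint]

theorem polygonMidpoint_heptagrid_six :
    polygonMidpoint 7 3 6 = ![polygonCosh 7 3,
      polygonSinh 7 3 * (2 * Real.cos (Real.pi / 7) ^ 2 - 1),
      polygonSinh 7 3 * (2 * Real.sin (Real.pi / 7) * Real.cos (Real.pi / 7))] := by
  have e : 2 * Real.pi * ((6 : Fin 7) : ℕ) / (7 : ℕ) = 2 * Real.pi - 2 * (Real.pi / 7) := by
    simp; ring
  rw [polygonMidpoint, e, Real.cos_two_pi_sub, Real.sin_two_pi_sub, Real.cos_two_mul,
    Real.sin_two_mul, mul_neg, neg_neg]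

theorem geometry_heptagrid : ∃ C : ℝ, Grid.heptagrid.Geometry (polygonSinh 7 3) C
    ![0, -Real.sin (Real.pi / 7), Real.cos (Real.pi / 7)] := by
  have hc := one_lt_polygonCosh_heptagrid
  have hs := polygonSinh_pos hc
  have hcs := polygonSinh_sq hc
  have hinj := polygonNormal_injective hc
  have hnorm := mink_polygonNormal hc
  have hheight := mink_origin_polygonNormal 7 3
  have hsum := sum_polygonNormal (p := 7) 3 (by norm_num)
  have n1 := polygonNormal_heptagrid_one
  have n5 := polygonNormal_heptagrid_five
  have m0 := polygonMidpoint_heptagrid_zero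
  have m6 := polygonMidpoint_heptagrid_six
  have hpi := Real.pi_pos
  have hcS := four_mul_polygonCosh_heptagrid_sq
  have hS : 0 < Real.sin (Real.pi / 7) :=
    Real.sin_pos_of_pos_of_lt_pi (by linarith) (by linarith)
  have hs3 : 0 < Real.sin (3 * (Real.pi / 7)) :=
    Real.sin_pos_of_pos_of_lt_pi (by linarith) (by linarith)
  have hK : 0 < Real.cos (Real.pi / 7) :=
    Real.cos_pos_of_mem_Ioo ⟨by linarith, by linarith⟩
  have hk3 : 0 < Real.cos (3 * (Real.pi / 7)) :=
    Real.cos_pos_of_mem_Ioo ⟨by linarith, by linarith⟩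
  have hSK := Real.sin_sq_add_cos_sq (Real.pi / 7)
  have hsk3 := Real.sin_sq_add_cos_sq (3 * (Real.pi / 7))
  have hc3 := Real.cos_three_mul (Real.pi / 7)
  have hmir : ∀ i, ∃ j, reflection (d := 2)
      ![0, -Real.sin (Real.pi / 7), Real.cos (Real.pi / 7)] (polygonNormal 7 3 i) =
      polygonNormal 7 3 j := by
    intro i
    refine ⟨i.rev, ?_⟩
    have e : 2 * (Real.pi / 7) + 2 * Real.pi * (i : ℕ) / (7 : ℕ)
        = 2 * Real.pi - 2 * Real.pi * (i.rev : ℕ) / (7 : ℕ) := by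
      have : ((i.rev : ℕ) : ℝ) = 6 - (i : ℕ) := by
        rw [Fin.val_rev, Nat.cast_sub (by omega)]; push_cast; ring
      rw [this]
      push_cast
      ring
    rw [polygonNormal, reflection_vec3, polygonNormal, e, Real.cos_two_pi_sub,
      Real.sin_two_pi_sub, mul_neg]
  set s := polygonSinh 7 3
  set c := polygonCosh 7 3
  set K := Real.cos (Real.pi / 7)
  set S := Real.sin (Real.pi / 7)
  set k := Real.cos (3 * (Real.pi / 7))
  set σ := Real.sin (3 * (Real.pi / 7))
  -- This relation says that the guideline, whose normal is `(s K, c K, c S)`, is orthogonal to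
  -- sides `1` and `5`. It combines the triple angle formula with `4 c² S² = 1`, which encodes the
  -- angle `2π/3`.
  have hrel : c ^ 2 * k = s ^ 2 * K := by
    rw [hc3, hcs]
    linear_combination (-K) * hcS + 4 * c ^ 2 * K * hSK
  have hC : mink (d := 2) (polygonNormal 7 3 1) (polygonNormal 7 3 5) =
      -(1 + 2 * s ^ 2 * (1 - K * k)) := by
    rw [n1, n5, mink_vec3]
    linear_combination c ^ 2 * (k ^ 2 - σ ^ 2) * hSK - c ^ 2 * hsk3 + hcs + 2 * k * hrel
  have hKk : K * k < 1 := by nlinarith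
  -- The two equations say that a vector orthogonal to both midpoints is proportional to `(s K, c K,
  -- c S)`.
  have hguide : ∀ w ∈ Grid.heptagrid.guide,
      S * w 1 = K * w 2 ∧ c * w 0 = s * K * (K * w 1 + S * w 2) := by
    rintro w ⟨h6, h0⟩
    have hw' : w = ![w 0, w 1, w 2] := mink_two_ext rfl rfl rfl
    rw [hw', m6, mink_vec3] at h6
    rw [hw', m0, mink_vec3] at h0
    have h1 : S * w 1 = K * w 2 := by
      apply mul_left_cancel₀ (show 2 * s * S ≠ 0 by positivity)
      linear_combination h0 - h6 + 2 * s * w 1 * hSK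
    refine ⟨h1, ?_⟩
    linear_combination (-1) * h0 - s * w 1 * hSK + s * S * h1
  refine ⟨1 + 2 * s ^ 2 * (1 - K * k), hs, ?_, ?_, hnorm, hheight, ⟨_, ?_, hsum⟩, hinj, hC, ?_,
    ?_, ?_, ?_, ?_, ?_, hmir⟩
  · have : 0 < s ^ 2 * (1 - K * k) := by
      have : 0 < 1 - K * k := by linarith
      positivity
    linarith
  · have : 0 < s ^ 2 * (K * k) := by positivity
    linarith
  · positivity
  · intro w hw
    obtain ⟨h1, h2⟩ := hguide w hw
    change mink (d := 2) w (polygonNormal 7 3 1) = 0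
    have hw' : w = ![w 0, w 1, w 2] := mink_two_ext rfl rfl rfl
    rw [hw', n1, mink_vec3]
    apply mul_left_cancel₀ (show c ≠ 0 by positivity)
    linear_combination (K * w 1 + S * w 2) * hrel + c ^ 2 * σ * h1 - s * h2
  · intro w hw
    obtain ⟨h1, h2⟩ := hguide w hw
    change mink (d := 2) w (polygonNormal 7 3 5) = 0
    have hw' : w = ![w 0, w 1, w 2] := mink_two_ext rfl rfl rfl
    rw [hw', n5, mink_vec3]
    apply mul_left_cancel₀ (show c ≠ 0 by positivity)
    linear_combination (K * w 1 + S * w 2) * hrel - c ^ 2 * σ * h1 - s * h2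
  · intro y hy
    have h0 := hy ![s * K, c * K, c * S] (by
      constructor
      · rw [m6, mink_vec3]
        linear_combination 2 * s * c * K * hSK
      · rw [m0, mink_vec3]
        ring)
    change ∃ α β : ℝ, y = α • polygonNormal 7 3 1 + β • polygonNormal 7 3 5
    have hy' : y = ![y 0, y 1, y 2] := mink_two_ext rfl rfl rfl
    rw [hy', mink_vec3] at h0
    have h1 : (K * y 1 + S * y 2) * s = y 0 * c * k := by
      apply mul_left_cancel₀ (show c ≠ 0 by positivity)
      linear_combination s * h0 - y 0 * hrel
    refine ⟨(y 0 / s - (K * y 2 - S * y 1) / (c * σ)) / 2,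
      (y 0 / s + (K * y 2 - S * y 1) / (c * σ)) / 2, ?_⟩
    rw [n1, n5]
    refine mink_two_ext ?_ ?_ ?_
    · simp; field_simp; ring
    · simp; field_simp
      linear_combination (-2 * σ * s * y 1) * hSK + 2 * σ * K * h1
    · simp; field_simp
      linear_combination (-2 * σ * s * y 2) * hSK + 2 * σ * S * h1
  · change origin 2 - _ • (polygonNormal 7 3 1 + polygonNormal 7 3 5) ∈ _
    have hKk' : 0 < 1 - K * k := by linarith
    have hl : s / (1 + 2 * s ^ 2 * (1 - K * k) - 1) = 1 / (2 * s * (1 - K * k)) := by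
      rw [add_sub_cancel_left, div_eq_div_iff (by positivity) (by positivity)]
      ring
    rw [hl]
    refine Submodule.subset_span ⟨?_, ?_⟩
    · rw [n1, n5, m6, origin_two, mink_sub_left, mink_smul_left, mink_add_left, mink_vec3,
        mink_vec3, mink_vec3]
      field_simp
      linear_combination (-4 * c * K * k) * hSK
    · rw [n1, n5, m0, origin_two, mink_sub_left, mink_smul_left, mink_add_left, mink_vec3,
        mink_vec3, mink_vec3]
      field_simp
      ring
  · rw [mink_vec3]
    linear_combination hSK
  · refine ⟨-1 / (2 * c * σ), ?_⟩
    change _ = _ • (polygonNormal 7 3 1 - polygonNormal 7 3 5)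
    rw [n1, n5]
    refine mink_two_ext ?_ ?_ ?_
    · simp
    · simp; field_simp; ring
    · simp; field_simp; ring

/-! ### The dodecagrid -/

theorem mink_vec4 (a b c e a' b' c' e' : ℝ) :
    mink (d := 3) ![a, b, c, e] ![a', b', c', e'] = -(a * a') + (b * b' + c * c' + e * e') := by
  simp [mink, Fin.sum_univ_three]

theorem mink_three_ext {x y : Mink 3} (h0 : x 0 = y 0) (h1 : x 1 = y 1) (h2 : x 2 = y 2)
    (h3 : x 3 = y 3) : x = y := by
  ext i
  fin_cases i
  exacts [h0, h1, h2, h3]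

theorem origin_three : origin 3 = ![1, 0, 0, 0] := by
  ext i
  fin_cases i <;> simp [origin]

theorem reflection_vec4 (ψ r c θ z : ℝ) :
    reflection (d := 3) ![0, -Real.sin ψ, Real.cos ψ, 0] ![r, c * Real.cos θ, c * Real.sin θ, z] =
      ![r, c * Real.cos (2 * ψ - θ), c * Real.sin (2 * ψ - θ), z] := by
  rw [reflection, mink_vec4, Real.cos_sub, Real.sin_sub, Real.cos_two_mul, Real.sin_two_mul]
  have := Real.sin_sq_add_cos_sq ψ
  refine mink_three_ext ?_ ?_ ?_ ?_
  · simp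
  · simp
    linear_combination (-2) * c * Real.cos θ * this
  · simp
    ring
  · simp

theorem cos_two_pi_div_five : Real.cos (2 * Real.pi / 5) = (√5 - 1) / 4 := by
  have h5 : √5 ^ 2 = 5 := Real.sq_sqrt (by norm_num)
  rw [show 2 * Real.pi / 5 = 2 * (Real.pi / 5) by ring, Real.cos_two_mul, Real.cos_pi_div_five]
  linear_combination (1 / 8) * h5

/-- The hyperbolic sine of the inradius of the right-angled regular dodecahedron. -/
def dodecahedronSinh : ℝ := √(1 / (√5 - 1))

/-- The last coordinate of the outward unit normals of the faces `1, …, 5`. -/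
def dodecahedronHeight : ℝ := √(√5 / (√5 - 1)) / √5

theorem sqrt_five_eq : √5 = 4 * Real.cos (2 * Real.pi / 5) + 1 := by
  rw [cos_two_pi_div_five]; ring

theorem cos_two_pi_div_five_sq :
    Real.cos (2 * Real.pi / 5) ^ 2 = (1 - 2 * Real.cos (2 * Real.pi / 5)) / 4 := by
  have h5 : √5 ^ 2 = 5 := Real.sq_sqrt (by norm_num)
  rw [cos_two_pi_div_five]
  linear_combination (1 / 16) * h5

theorem cos_two_pi_div_five_pos : 0 < Real.cos (2 * Real.pi / 5) := by
  have := Real.pi_pos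
  exact Real.cos_pos_of_mem_Ioo ⟨by linarith, by linarith⟩

theorem dodecahedronSinh_sq : dodecahedronSinh ^ 2 = 1 / 2 + Real.cos (2 * Real.pi / 5) := by
  have hk := cos_two_pi_div_five_pos
  rw [dodecahedronSinh, sqrt_five_eq, add_sub_cancel_right, Real.sq_sqrt (by positivity)]
  field_simp
  linear_combination (-8) * cos_two_pi_div_five_sq

theorem dodecahedronHeight_sq :
    dodecahedronHeight ^ 2 = (3 + 2 * Real.cos (2 * Real.pi / 5)) / 10 := by
  have hk := cos_two_pi_div_five_pos
  rw [dodecahedronHeight, sqrt_five_eq, add_sub_cancel_right, div_pow, Real.sq_sqrt (by positivity)]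
  field_simp
  linear_combination (-(40 + 32 * Real.cos (2 * Real.pi / 5))) * cos_two_pi_div_five_sq

theorem dodecahedronNormal_eq {i : Fin 12} {x y z : ℝ}
    (h : dodecahedronDirection i = ![x, y, z]) : dodecahedronNormal i =
      ![dodecahedronSinh, √5 * dodecahedronHeight * x, √5 * dodecahedronHeight * y,
        √5 * dodecahedronHeight * z] := by
  have h5 : √5 * dodecahedronHeight = √(√5 / (√5 - 1)) := by
    rw [dodecahedronHeight, mul_div_cancel₀]
    positivity
  rw [h5, dodecahedronNormal, h]
  exact mink_three_ext rfl rfl rfl rfl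

/-- The face number `1 + j` of the dodecahedron. -/
def upperFace (j : Fin 5) : Fin 12 := ⟨j + 1, by omega⟩

/-- The face number `6 + j` of the dodecahedron. -/
def lowerFace (j : Fin 5) : Fin 12 := ⟨j + 6, by omega⟩

theorem dodecahedron_face_cases (i : Fin 12) :
    i = 0 ∨ (∃ j, i = upperFace j) ∨ (∃ j, i = lowerFace j) ∨ i = 11 := by
  revert i
  decide

theorem sum_dodecahedron_faces {M : Type*} [AddCommMonoid M] (f : Fin 12 → M) :
    ∑ i, f i = f 0 + ∑ j, f (upperFace j) + ∑ j, f (lowerFace j) + f 11 := by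
  rw [Fin.sum_univ_five, Fin.sum_univ_five]
  simp only [Fin.sum_univ_succ, Fin.sum_univ_zero, upperFace, lowerFace]
  simp only [add_zero, add_assoc]
  rfl

theorem dodecahedronNormal_zero : dodecahedronNormal 0 =
    ![dodecahedronSinh, 0, 0, (4 * Real.cos (2 * Real.pi / 5) + 1) * dodecahedronHeight] := by
  rw [dodecahedronNormal_eq (x := 0) (y := 0) (z := 1) (by simp [dodecahedronDirection]),
    ← sqrt_five_eq, mul_zero, mul_one]

theorem dodecahedronNormal_eleven : dodecahedronNormal 11 =
    ![dodecahedronSinh, 0, 0, -((4 * Real.cos (2 * Real.pi / 5) + 1) * dodecahedronHeight)] := by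
  rw [dodecahedronNormal_eq (x := 0) (y := 0) (z := -1) (by simp [dodecahedronDirection]),
    ← sqrt_five_eq, mul_zero, mul_neg, mul_one]

theorem dodecahedronNormal_upper (j : Fin 5) : dodecahedronNormal (upperFace j) =
    ![dodecahedronSinh, 2 * dodecahedronHeight * Real.cos (2 * Real.pi * (j : ℕ) / (5 : ℕ)),
      2 * dodecahedronHeight * Real.sin (2 * Real.pi * (j : ℕ) / (5 : ℕ)),
      dodecahedronHeight] := by
  have h5 : (√5 : ℝ) ≠ 0 := by positivity
  have h1 : (upperFace j : ℕ) ≤ 5 := by have := j.2; simp only [upperFace]; omega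
  rw [dodecahedronNormal_eq (by
    rw [dodecahedronDirection, if_neg (by simp [upperFace]), if_pos h1])]
  have h2 : ((upperFace j : ℕ) : ℝ) - 1 = (j : ℕ) := by simp [upperFace]
  rw [h2]
  refine mink_three_ext ?_ ?_ ?_ ?_ <;> simp <;> field_simp

theorem dodecahedronNormal_lower (j : Fin 5) : dodecahedronNormal (lowerFace j) =
    ![dodecahedronSinh,
      2 * dodecahedronHeight * Real.cos (2 * Real.pi * (j : ℕ) / (5 : ℕ) - Real.pi / 5),
      2 * dodecahedronHeight * Real.sin (2 * Real.pi * (j : ℕ) / (5 : ℕ) - Real.pi / 5),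
      -dodecahedronHeight] := by
  have h5 : (√5 : ℝ) ≠ 0 := by positivity
  have h1 : (lowerFace j : ℕ) ≤ 10 := by have := j.2; simp only [lowerFace]; omega
  rw [dodecahedronNormal_eq (by
    rw [dodecahedronDirection, if_neg (by simp [lowerFace]), if_neg (by simp [lowerFace]),
      if_pos h1])]
  have h2 : ((lowerFace j : ℕ) : ℝ) - 6 = (j : ℕ) := by simp [lowerFace]
  rw [h2]
  refine mink_three_ext ?_ ?_ ?_ ?_ <;> simp <;> field_simp

theorem dodecahedronNormal_one : dodecahedronNormal 1 =
    ![dodecahedronSinh, 2 * dodecahedronHeight, 0, dodecahedronHeight] := by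
  rw [show (1 : Fin 12) = upperFace 0 from rfl, dodecahedronNormal_upper]
  simp

theorem dodecahedronNormal_three : dodecahedronNormal 3 =
    ![dodecahedronSinh, 2 * dodecahedronHeight * (2 * Real.cos (2 * Real.pi / 5) ^ 2 - 1),
      2 * dodecahedronHeight * (2 * Real.sin (2 * Real.pi / 5) * Real.cos (2 * Real.pi / 5)),
      dodecahedronHeight] := by
  rw [show (3 : Fin 12) = upperFace 2 from rfl, dodecahedronNormal_upper,
    show 2 * Real.pi * ((2 : Fin 5) : ℕ) / (5 : ℕ) = 2 * (2 * Real.pi / 5) by simp; ring,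
    Real.cos_two_mul, Real.sin_two_mul]

theorem dodecahedronNormal_four : dodecahedronNormal 4 =
    ![dodecahedronSinh, 2 * dodecahedronHeight * (2 * Real.cos (2 * Real.pi / 5) ^ 2 - 1),
      -(2 * dodecahedronHeight * (2 * Real.sin (2 * Real.pi / 5) * Real.cos (2 * Real.pi / 5))),
      dodecahedronHeight] := by
  rw [show (4 : Fin 12) = upperFace 3 from rfl, dodecahedronNormal_upper,
    show 2 * Real.pi * ((3 : Fin 5) : ℕ) / (5 : ℕ) = 2 * Real.pi - 2 * (2 * Real.pi / 5) by
      simp; ring,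
    Real.cos_two_pi_sub, Real.sin_two_pi_sub, Real.cos_two_mul, Real.sin_two_mul, mul_neg]

theorem dodecahedronNormal_five : dodecahedronNormal 5 =
    ![dodecahedronSinh, 2 * dodecahedronHeight * Real.cos (2 * Real.pi / 5),
      -(2 * dodecahedronHeight * Real.sin (2 * Real.pi / 5)), dodecahedronHeight] := by
  rw [show (5 : Fin 12) = upperFace 4 from rfl, dodecahedronNormal_upper,
    show 2 * Real.pi * ((4 : Fin 5) : ℕ) / (5 : ℕ) = 2 * Real.pi - 2 * Real.pi / 5 by
      simp; ring,
    Real.cos_two_pi_sub, Real.sin_two_pi_sub, mul_neg]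

theorem dodecahedronSinh_pos : 0 < dodecahedronSinh := by
  have := cos_two_pi_div_five_pos
  rw [dodecahedronSinh, sqrt_five_eq, add_sub_cancel_right]
  positivity

theorem dodecahedronHeight_pos : 0 < dodecahedronHeight := by
  have := cos_two_pi_div_five_pos
  rw [dodecahedronHeight, sqrt_five_eq, add_sub_cancel_right]
  positivity

theorem mink_dodecahedronNormal (i : Fin 12) :
    mink (dodecahedronNormal i) (dodecahedronNormal i) = 1 := by
  have hs := dodecahedronSinh_sq
  have hB := dodecahedronHeight_sq
  have hk := cos_two_pi_div_five_sq
  set k := Real.cos (2 * Real.pi / 5)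
  have h0 : ((4 * k + 1) * dodecahedronHeight) ^ 2 - dodecahedronSinh ^ 2 = 1 := by
    rw [mul_pow, hB, hs]
    linear_combination (32 * k + 48) / 10 * hk
  have h1 : 5 * dodecahedronHeight ^ 2 - dodecahedronSinh ^ 2 = 1 := by
    rw [hB, hs]
    ring
  rcases dodecahedron_face_cases i with rfl | ⟨j, rfl⟩ | ⟨j, rfl⟩ | rfl
  · rw [dodecahedronNormal_zero, mink_vec4]
    linear_combination h0
  · rw [dodecahedronNormal_upper, mink_vec4]
    linear_combination h1 + 4 * dodecahedronHeight ^ 2 *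
      Real.sin_sq_add_cos_sq (2 * Real.pi * (j : ℕ) / (5 : ℕ))
  · rw [dodecahedronNormal_lower, mink_vec4]
    linear_combination h1 + 4 * dodecahedronHeight ^ 2 *
      Real.sin_sq_add_cos_sq (2 * Real.pi * (j : ℕ) / (5 : ℕ) - Real.pi / 5)
  · rw [dodecahedronNormal_eleven, mink_vec4]
    linear_combination h0

theorem mink_origin_dodecahedronNormal (i : Fin 12) :
    mink (origin 3) (dodecahedronNormal i) = -dodecahedronSinh := by
  rw [mink_comm, mink_origin]
  rfl

theorem sum_dodecahedronNormal :
    ∑ i, dodecahedronNormal i = (12 * dodecahedronSinh) • origin 3 := by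
  obtain ⟨h1, h2⟩ := sum_cos_sin_eq_zero (p := 5) (by norm_num)
  rw [sum_dodecahedron_faces, dodecahedronNormal_zero, dodecahedronNormal_eleven, origin_three]
  simp only [dodecahedronNormal_upper, dodecahedronNormal_lower]
  refine mink_three_ext ?_ ?_ ?_ ?_
  all_goals simp only [Pi.add_apply, Finset.sum_apply, Matrix.cons_val, Pi.smul_apply, smul_eq_mul,
    sum_const, card_univ, Fintype.card_fin, nsmul_eq_mul, Real.cos_sub, Real.sin_sub,
    sum_add_distrib, sum_sub_distrib, ← mul_sum, ← sum_mul, h1, h2]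
  all_goals push_cast; ring

theorem eq_of_cos_sub_eq_of_sin_sub_eq {i j : Fin 5} {a : ℝ}
    (hc : Real.cos (2 * Real.pi * (i : ℕ) / (5 : ℕ) - a) =
      Real.cos (2 * Real.pi * (j : ℕ) / (5 : ℕ) - a))
    (hs : Real.sin (2 * Real.pi * (i : ℕ) / (5 : ℕ) - a) =
      Real.sin (2 * Real.pi * (j : ℕ) / (5 : ℕ) - a)) : i = j := by
  apply eq_of_cos_eq_of_sin_eq
  · rw [← sub_add_cancel (2 * Real.pi * (i : ℕ) / (5 : ℕ)) a, Real.cos_add, hc, hs,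
      ← Real.cos_add, sub_add_cancel]
  · rw [← sub_add_cancel (2 * Real.pi * (i : ℕ) / (5 : ℕ)) a, Real.sin_add, hc, hs,
      ← Real.sin_add, sub_add_cancel]

theorem dodecahedronNormal_injective : Function.Injective dodecahedronNormal := by
  have hB := dodecahedronHeight_pos
  have hk := cos_two_pi_div_five_pos
  have hkB : 0 < Real.cos (2 * Real.pi / 5) * dodecahedronHeight := by positivity
  intro i i' h
  have h1 := congrFun h 1
  have h2 := congrFun h 2
  have h3 := congrFun h 3
  have hu : ∀ j j', dodecahedronNormal (upperFace j) = dodecahedronNormal (upperFace j') →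
      j = j' := by
    intro j j' h
    have h1 := congrFun h 1
    have h2 := congrFun h 2
    simp only [dodecahedronNormal_upper, Matrix.cons_val] at h1 h2
    exact eq_of_cos_eq_of_sin_eq (mul_left_cancel₀ (by positivity) h1)
      (mul_left_cancel₀ (by positivity) h2)
  have hl : ∀ j j', dodecahedronNormal (lowerFace j) = dodecahedronNormal (lowerFace j') →
      j = j' := by
    intro j j' h
    have h1 := congrFun h 1
    have h2 := congrFun h 2
    simp only [dodecahedronNormal_lower, Matrix.cons_val] at h1 h2
    exact eq_of_cos_sub_eq_of_sin_sub_eq (mul_left_cancel₀ (by positivity) h1)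
      (mul_left_cancel₀ (by positivity) h2)
  rcases dodecahedron_face_cases i with rfl | ⟨j, rfl⟩ | ⟨j, rfl⟩ | rfl <;>
  rcases dodecahedron_face_cases i' with rfl | ⟨j', rfl⟩ | ⟨j', rfl⟩ | rfl <;>
  first
  | rfl
  | rw [hu _ _ h]
  | rw [hl _ _ h]
  | (simp only [dodecahedronNormal_zero, dodecahedronNormal_upper, dodecahedronNormal_lower,
      dodecahedronNormal_eleven, Matrix.cons_val] at h3
     linarith)

/-- The mirror contains the directions of faces `0` and `5`. It acts by `j ↦ 3 - j` modulo `5` on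
the upper faces and by `j ↦ 4 - j` on the lower ones, so it exchanges faces `1` and `4`. -/
theorem mirror_dodecahedronNormal (i : Fin 12) : ∃ j, reflection (d := 3)
    ![0, -Real.sin (8 * Real.pi / 5), Real.cos (8 * Real.pi / 5), 0] (dodecahedronNormal i) =
      dodecahedronNormal j := by
  rcases dodecahedron_face_cases i with rfl | ⟨j, rfl⟩ | ⟨j, rfl⟩ | rfl
  · refine ⟨0, ?_⟩
    rw [dodecahedronNormal_zero, reflection, mink_vec4]
    simp
  · have key : ∀ j j' : Fin 5, ∀ m : ℕ, (8 : ℝ) - (j : ℕ) = (j' : ℕ) + 5 * m → ∃ i, reflection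
        (d := 3) ![0, -Real.sin (8 * Real.pi / 5), Real.cos (8 * Real.pi / 5), 0]
        (dodecahedronNormal (upperFace j)) = dodecahedronNormal i := by
      intro j j' m h
      refine ⟨upperFace j', ?_⟩
      have e : 2 * (8 * Real.pi / 5) - 2 * Real.pi * (j : ℕ) / (5 : ℕ) =
          2 * Real.pi * (j' : ℕ) / (5 : ℕ) + m * (2 * Real.pi) := by
        push_cast
        linear_combination 2 * Real.pi / 5 * h
      rw [dodecahedronNormal_upper, reflection_vec4, dodecahedronNormal_upper, e,
        Real.cos_add_nat_mul_two_pi, Real.sin_add_nat_mul_two_pi]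
    fin_cases j
    · exact key 0 3 1 (by norm_num)
    · exact key 1 2 1 (by norm_num)
    · exact key 2 1 1 (by norm_num)
    · exact key 3 0 1 (by norm_num)
    · exact key 4 4 0 (by norm_num)
  · refine ⟨lowerFace j.rev, ?_⟩
    have h : ((j.rev : ℕ) : ℝ) = 4 - (j : ℕ) := by
      rw [Fin.val_rev, Nat.cast_sub (by omega)]; push_cast; ring
    have e : 2 * (8 * Real.pi / 5) - (2 * Real.pi * (j : ℕ) / (5 : ℕ) - Real.pi / 5) =
        2 * Real.pi * (j.rev : ℕ) / (5 : ℕ) - Real.pi / 5 + 2 * Real.pi := by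
      rw [h]
      push_cast
      ring
    rw [dodecahedronNormal_lower, reflection_vec4, dodecahedronNormal_lower, e,
        Real.cos_add_two_pi, Real.sin_add_two_pi]
  · refine ⟨11, ?_⟩
    rw [dodecahedronNormal_eleven, reflection, mink_vec4]
    simp

/-- Here `φ` is the golden ratio, equal to `2 cos (2π/5) + 1`, and also the hyperbolic cosine of the
shift length. The last relation is a fact about regular pentagons: the diagonal from `1` to `3` is
parallel to the side from `5` to `4` and `φ` times as long. -/
theorem geometry_dodecagrid : ∃ (s φ : ℝ) (b : Mink 3), Grid.dodecagrid.Geometry s φ b ∧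
    φ ^ 2 = φ + 1 ∧ 2 * s ^ 2 = φ ∧
    dodecahedronNormal 3 =
      dodecahedronNormal 1 + φ • dodecahedronNormal 4 - φ • dodecahedronNormal 5 := by
  have n0 := dodecahedronNormal_zero
  have n1 := dodecahedronNormal_one
  have n3 := dodecahedronNormal_three
  have n4 := dodecahedronNormal_four
  have n5 := dodecahedronNormal_five
  have hs := dodecahedronSinh_sq
  have hB := dodecahedronHeight_sq
  have hk := cos_two_pi_div_five_sq
  have hk0 := cos_two_pi_div_five_pos
  have hs0 := dodecahedronSinh_pos
  have hB0 := dodecahedronHeight_pos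
  have hpi := Real.pi_pos
  have hσ0 : 0 < Real.sin (2 * Real.pi / 5) :=
    Real.sin_pos_of_pos_of_lt_pi (by linarith) (by linarith)
  have hσ := Real.sin_sq_add_cos_sq (2 * Real.pi / 5)
  have hc8 : Real.cos (8 * Real.pi / 5) = Real.cos (2 * Real.pi / 5) := by
    rw [← Real.cos_two_pi_sub]; congr 1; ring
  have hs8 : Real.sin (8 * Real.pi / 5) = -Real.sin (2 * Real.pi / 5) := by
    rw [← Real.sin_two_pi_sub]; congr 1; ring
  have hmir := mirror_dodecahedronNormal
  rw [hc8, hs8, neg_neg] at hmir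
  have hnorm := mink_dodecahedronNormal
  have hheight := mink_origin_dodecahedronNormal
  have hsum := sum_dodecahedronNormal
  set k := Real.cos (2 * Real.pi / 5)
  set σ := Real.sin (2 * Real.pi / 5)
  set s := dodecahedronSinh
  set B := dodecahedronHeight
  -- This is the right dihedral angle between face `0` and its neighbours, with `√5 = 4 k + 1`.
  have hsB : s ^ 2 = (4 * k + 1) * B ^ 2 := by
    rw [hs, hB]
    linear_combination (-4 / 5) * hk
  have hC : mink (dodecahedronNormal 1) (dodecahedronNormal 4) = -(2 * k + 1) := by
    rw [n1, n4, mink_vec4]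
    linear_combination (-1) * hs + (8 * k ^ 2 - 3) * hB + (16 * k + 16) / 10 * hk
  have h01 : mink (dodecahedronNormal 0) (dodecahedronNormal 1) = 0 := by
    rw [n0, n1, mink_vec4]
    linear_combination (-1) * hsB
  have h04 : mink (dodecahedronNormal 0) (dodecahedronNormal 4) = 0 := by
    rw [n0, n4, mink_vec4]
    linear_combination (-1) * hsB
  have h51 : mink (dodecahedronNormal 5) (dodecahedronNormal 1) = 0 := by
    rw [n5, n1, mink_vec4]
    linear_combination (-1) * hsB
  have h54 : mink (dodecahedronNormal 5) (dodecahedronNormal 4) = 0 := by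
    rw [n5, n4, mink_vec4]
    linear_combination (-1) * hsB + 8 * B ^ 2 * k * hσ
  refine ⟨s, 2 * k + 1, ![0, σ, k, 0], ⟨hs0, by linarith, by linarith, hnorm, hheight,
    ⟨_, ?_, hsum⟩, dodecahedronNormal_injective, hC, ?_, ?_, ?_, ?_, ?_, ?_, hmir⟩, ?_, ?_, ?_⟩
  · positivity
  · rintro w (rfl | rfl)
    exacts [h01, h51]
  · rintro w (rfl | rfl)
    exacts [h04, h54]
  · intro y hy
    have h0 := hy _ (Set.mem_insert _ _)
    have h5 := hy _ (Set.mem_insert_of_mem _ rfl)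
    change ∃ α β : ℝ, y = α • dodecahedronNormal 1 + β • dodecahedronNormal 4
    have hy' : y = ![y 0, y 1, y 2, y 3] := mink_three_ext rfl rfl rfl rfl
    rw [hy', n0, mink_vec4] at h0
    rw [hy', n5, mink_vec4] at h5
    have e0 : y 0 * B = s * y 3 := by
      apply mul_left_cancel₀ hs0.ne'
      linear_combination (-B) * h0 - y 3 * hsB
    have ep : k * y 1 - σ * y 2 = 2 * k * y 3 := by
      apply mul_left_cancel₀ hB0.ne'
      linear_combination (1 / 2) * h5 - (1 / 2) * h0
    -- The last coordinate gives `α + β`, and the component along the mirror normal `(σ, k)` gives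
    -- `α - β`.
    refine ⟨(y 3 / B + (σ * y 1 + k * y 2) / (2 * B * σ)) / 2,
      (y 3 / B - (σ * y 1 + k * y 2) / (2 * B * σ)) / 2, ?_⟩
    rw [n1, n4]
    refine mink_three_ext ?_ ?_ ?_ ?_
    · simp; field_simp
      linear_combination 4 * σ * e0
    · simp; field_simp
      linear_combination 2 * σ * k * ep + 2 * k * y 2 * hσ
    · simp; field_simp
      linear_combination (-σ) * ep - y 2 * hσ
    · simp; field_simp
      ring
  · change origin 3 - _ • (dodecahedronNormal 1 + dodecahedronNormal 4) ∈
      Submodule.span ℝ {dodecahedronNormal 0, dodecahedronNormal 5}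
    rw [Submodule.mem_span_pair]
    -- The normals of faces `0` and `5` are orthonormal, and each has product `-s` with the centre.
    refine ⟨-s, -s, ?_⟩
    rw [n0, n1, n4, n5, origin_three, add_sub_cancel_right]
    refine mink_three_ext ?_ ?_ ?_ ?_
    · simp; field_simp
      linear_combination (2 - 4 * k) * hs - 4 * hk
    · simp; field_simp
      ring
    · simp; field_simp
    · simp; field_simp
      linear_combination (-8) * hk
  · rw [mink_vec4]
    linear_combination hσ
  · refine ⟨1 / (4 * B * σ), ?_⟩
    change _ = _ • (dodecahedronNormal 1 - dodecahedronNormal 4)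
    rw [n1, n4]
    refine mink_three_ext ?_ ?_ ?_ ?_
    · simp
    · simp; field_simp
      linear_combination 4 * hσ
    · simp; field_simp
      ring
    · simp
  · linear_combination 4 * hk
  · linear_combination 2 * hs
  · rw [n1, n3, n4, n5]
    refine mink_three_ext ?_ ?_ ?_ ?_
    · simp
    · simp
      linear_combination 2 * B * (4 - 4 * k) * hk
    · simp
      linear_combination 8 * B * σ * hk
    · simp

/-! ### The marked neighbours of a line of the dodecagrid -/

/-- The centre of the marked neighbour of a cell of a line of the dodecagrid. -/
def Line.markCentre (s : ℝ) (ℓ : Line .dodecagrid) (k : ℤ) : Mink 3 :=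
  ℓ.centre k + (2 * s) • (ℓ.place k).motion (dodecahedronNormal 3)

/-- Through the pentagon relation, the normal of the marked face is a combination of the two walls
and of the normal `F` of face `5`, which is the same for all cells. The centre of a marked cell is
thus a combination of two walls plus a constant vector, and its products reduce to values of `cosh
(m L)`. -/
theorem exists_mink_markCentre {s φ : ℝ} {b : Mink 3} (h : Grid.dodecagrid.Geometry s φ b)
    (hφ : φ ^ 2 = φ + 1) (hs : 2 * s ^ 2 = φ)
    (h3 : dodecahedronNormal 3 =
      dodecahedronNormal 1 + φ • dodecahedronNormal 4 - φ • dodecahedronNormal 5)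
    (ℓ : Line .dodecagrid) : ∃ L : ℝ, 0 < L ∧ Real.cosh L = φ ∧
      (∀ j k, mink (ℓ.centre j) (ℓ.markCentre s k) =
        φ ^ 2 * (2 + (φ - 1) * Real.cosh ((k - j - 1 : ℤ) * L) -
          (φ + 2) * Real.cosh ((k - j : ℤ) * L)) - 1) ∧
      ∀ j k, mink (ℓ.markCentre s j) (ℓ.markCentre s k) =
        -1 - s ^ 2 * (10 * φ + 4) * (Real.cosh ((k - j : ℤ) * L) - 1) := by
  obtain ⟨L, hL, hC, hw⟩ := h.exists_length ℓ
  obtain ⟨w, hw0, hw1, hw2⟩ := h.exists_axis ℓ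
  have hs0 := h.s_pos
  have hφ1 := h.one_lt
  have hlam : s / (φ - 1) = s * φ := by
    rw [div_eq_iff (by linarith)]
    linear_combination (-s) * hφ
  have hw1' : mink w w = φ := by
    rw [hw1, hs, sub_eq_iff_eq_add, div_eq_iff (by linarith)]
    linear_combination (-1) * hφ
  rw [hlam] at hw2
  have h5 : dodecahedronNormal 5 ∈ Submodule.span ℝ Grid.dodecagrid.guide :=
    Submodule.subset_span (Or.inr rfl)
  set F := (ℓ.place 0).motion (dodecahedronNormal 5)
  have hF : ∀ k, (ℓ.place k).motion (dodecahedronNormal 5) = F := fun k =>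
    ℓ.eq_on_span_guide h5 k 0
  have hFF : mink F F = 1 := by
    rw [(ℓ.place 0).motion_mem.1]
    exact h.norm 5
  have hFw : ∀ k, mink F (ℓ.wall k) = 0 := fun k => by
    rw [← hF k, Line.wall, (ℓ.place k).motion_mem.1]
    exact h.guide_right _ (Or.inr rfl)
  have hwF : mink w F = -s := by
    have h1 : mink (ℓ.centre 0) F = -s := by
      rw [Line.centre, (ℓ.place 0).motion_mem.1]
      exact h.height 5
    rw [hw2, mink_add_left, mink_smul_left, mink_sub_left, mink_comm _ F, mink_comm _ F, hFw,
      hFw] at h1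
    linarith
  have hn : ∀ k, (ℓ.place k).motion (dodecahedronNormal 3) =
      φ • ℓ.wall k - ℓ.wall (k - 1) - φ • F := by
    intro k
    have hl : (ℓ.place k).motion (dodecahedronNormal 1) = -ℓ.wall (k - 1) := ℓ.left_eq_neg_wall k
    have hr : (ℓ.place k).motion (dodecahedronNormal 4) = ℓ.wall k := rfl
    rw [h3, map_sub, map_add, map_smul, map_smul, hl, hr, hF]
    module
  have hd : ∀ k, ℓ.markCentre s k =
      (3 * s * φ) • ℓ.wall k - (s * φ + 2 * s) • ℓ.wall (k - 1) + (w - (2 * s * φ) • F) := by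
    intro k
    rw [Line.markCentre, hn, hw2]
    module
  have hcosh : ∀ x, Real.cosh (x + L) = 2 * φ * Real.cosh x - Real.cosh (x - L) := by
    intro x
    rw [Real.cosh_add, Real.cosh_sub, hC]
    ring
  have e1 : ∀ j k : ℤ, ((k - j - 1 : ℤ) : ℝ) * L = ((k - j : ℤ) : ℝ) * L - L := by
    intro j k; push_cast; ring
  have e2 : ∀ j k : ℤ, ((k - 1 - j : ℤ) : ℝ) * L = ((k - j : ℤ) : ℝ) * L - L := by
    intro j k; push_cast; ring
  have e3 : ∀ j k : ℤ, ((k - (j - 1) : ℤ) : ℝ) * L = ((k - j : ℤ) : ℝ) * L + L := by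
    intro j k; push_cast; ring
  have e4 : ∀ j k : ℤ, ((k - 1 - (j - 1) : ℤ) : ℝ) * L = ((k - j : ℤ) : ℝ) * L := by
    intro j k; push_cast; ring
  have hw0' : ∀ k, mink (ℓ.wall k) w = 0 := fun k => by rw [mink_comm, hw0]
  have hFw' : ∀ k, mink (ℓ.wall k) F = 0 := fun k => by rw [mink_comm, hFw]
  have hwF' : mink F w = -s := by rw [mink_comm, hwF]
  refine ⟨L, hL, hC, fun j k => ?_, fun j k => ?_⟩
  · simp only [hd, hw2, mink_sub_left, mink_sub_right, mink_smul_left, mink_smul_right,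
      mink_add_left, mink_add_right, hw0, hw0', hw1', hFw', hwF, hw]
    rw [e4, e3, e2, e1, hcosh]
    -- What remains is a polynomial identity modulo `φ² = φ + 1` and `2 s² = φ`, with the two
    -- hyperbolic cosines as free variables.
    generalize Real.cosh _ = H
    generalize Real.cosh _ = X
    clear * - hφ hs
    grind
  · simp only [hd, mink_sub_left, mink_sub_right, mink_smul_left, mink_smul_right,
      mink_add_left, mink_add_right, hw0, hw0', hw1', hFw, hFw', hFF, hwF, hwF', hw]
    rw [e4, e3, e2, hcosh]
    generalize Real.cosh _ = H
    generalize Real.cosh _ = X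
    clear * - hφ hs
    grind

/-- Adjacent tiles have centres with product `-1 - 2 s² = -1 - φ`. Between a line cell and a mark,
index difference `0` attains this value and any other difference gives strictly less. Between two
marks the product is `-1` for equal indices and falls well below `-1 - φ` otherwise. -/
theorem eq_of_mink_markCentre {s φ : ℝ} {b : Mink 3} (h : Grid.dodecagrid.Geometry s φ b)
    (hφ : φ ^ 2 = φ + 1) (hs : 2 * s ^ 2 = φ)
    (h3 : dodecahedronNormal 3 =
      dodecahedronNormal 1 + φ • dodecahedronNormal 4 - φ • dodecahedronNormal 5)
    (ℓ : Line .dodecagrid) :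
    (∀ j k, mink (ℓ.centre j) (ℓ.markCentre s k) = -1 - 2 * s ^ 2 → j = k) ∧
    ∀ j k, mink (ℓ.markCentre s j) (ℓ.markCentre s k) ≠ -1 - 2 * s ^ 2 := by
  obtain ⟨L, hL, hC, hm, hd⟩ := exists_mink_markCentre h hφ hs h3 ℓ
  have hφ1 := h.one_lt
  have hH : ∀ e : ℤ, e ≠ 0 → φ ≤ Real.cosh (e * L) := by
    intro e he
    have := cosh_int_mul_le hL (i := 1) (j := e) (by rw [abs_one]; exact Int.one_le_abs he)
    rwa [Int.cast_one, one_mul, hC] at this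
  have key : ∀ e : ℤ, e ≠ 0 →
      (φ - 1) * Real.cosh ((e - 1 : ℤ) * L) - (φ + 2) * Real.cosh (e * L) < -1 - φ := by
    intro e he
    have h1 := hH e he
    rcases lt_or_gt_of_ne he with h2 | h2
    · have h3 := Real.one_le_cosh ((e + 1 : ℤ) * L)
      -- For `e < 0` the term `e - 1` is the larger one in absolute value. The recurrence trades it
      -- for `e + 1`; since `2 φ (φ - 1) = 2`, the whole becomes `-φ cosh (e L) - (φ - 1) cosh ((e +
      -- 1) L)`, at most `-2 φ`.
      have h4 : Real.cosh ((e - 1 : ℤ) * L) =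
          2 * φ * Real.cosh (e * L) - Real.cosh ((e + 1 : ℤ) * L) := by
        have e1 : ((e - 1 : ℤ) : ℝ) * L = e * L - L := by push_cast; ring
        have e2 : ((e + 1 : ℤ) : ℝ) * L = e * L + L := by push_cast; ring
        rw [e1, e2, Real.cosh_sub, Real.cosh_add, hC]
        ring
      rw [h4]
      nlinarith
    · have h3 := cosh_int_mul_le hL (i := e - 1) (j := e)
        (by rw [abs_of_nonneg (by omega), abs_of_nonneg (by omega)]; omega)
      nlinarith
  have hφ2 : 0 < φ ^ 2 := by positivity
  refine ⟨fun j k hjk => ?_, fun j k hjk => ?_⟩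
  · by_contra hne
    have h1 := key (k - j) (by omega)
    rw [hm, hs] at hjk
    nlinarith
  · rw [hd, hs] at hjk
    have hs' : s ^ 2 = φ / 2 := by linarith
    rw [hs'] at hjk
    rcases eq_or_ne (k - j) 0 with h0 | h0
    · rw [h0, Int.cast_zero, zero_mul, Real.cosh_zero] at hjk
      linarith
    · have h1 := hH _ h0
      -- The left-hand side equals `4 φ + 6`, well above the value `2` required for adjacency.
      have h2 : (10 * φ + 4) * (φ - 1) ≤
          (10 * φ + 4) * (Real.cosh ((k - j : ℤ) * L) - 1) := by gcongr
      nlinarith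

/-! ### The automaton on the grid -/

section Labels

variable {G : Grid}

/-- A labelling of the faces of a tile tells which states a cell sees through them: `0` stands
for the state of the left-hand neighbour on the line, `1` for the state of the right-hand
neighbour, `2` for the state of a marked cell, `3` for the extra state. -/
abbrev Labelling (G : Grid) : Type := Fin G.faces → Fin 4

open Classical in
/-- The labelling of the faces of a cell of a line. -/
def Grid.label (G : Grid) (marks : Set (Fin G.faces)) : Labelling G := fun i =>
  if i = G.left then 0 else if i = G.right then 1 else if i ∈ marks then 2 else 3

/-- The rotated forms of the labelling of a cell of a line. -/
def Grid.labellings (G : Grid) : Set (Labelling G) :=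
  {L | ∃ μ ∈ G.rotations, L = G.label G.marks ∘ μ}

/-- The labellings without mark which are used in the dodecagrid, regardless of the direction of
the line. -/
def Grid.undirectedLabellings (G : Grid) : Set (Labelling G) :=
  {L | G = .dodecagrid ∧
    ∃ μ ∈ G.rotations, L = G.label ∅ ∘ μ ∨ L = Equiv.swap 0 1 ∘ G.label ∅ ∘ μ}

/-- The state which is seen through a face with a given label. -/
def fill {n : ℕ} (x y : Fin n) : Fin 4 → Fin (n + 1) :=
  ![x.castSucc, y.castSucc, 0, Fin.last n]

/-- The labellings which apply to the states `x`, `y` of the neighbours on the line. -/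
def Applies {n : ℕ} (L : Labelling G) (x y : Fin n) : Prop :=
  -- Without a mark, left and right cannot be told apart; ordering the two states makes the reading
  -- unique for every rule, symmetric or not, so that one automaton serves both kinds of background.
  L ∈ G.labellings ∨ L ∈ G.undirectedLabellings ∧ x ≤ y

/-- The contexts in which a cell may change its state, with the new state. -/
def Active {n : ℕ} (A : LineCA n) (s : Fin (n + 1)) (c : Fin G.faces → Fin (n + 1))
    (s' : Fin (n + 1)) : Prop :=
  ∃ x s₀ y : Fin n, ∃ L : Labelling G, Applies L x y ∧ s = s₀.castSucc ∧
    c = fill x y ∘ L ∧ s' = (A.rule x s₀ y).castSucc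

open Classical in
/-- The automaton on the grid which simulates a one-dimensional automaton on the lines. -/
def LineCA.toGrid {n : ℕ} (A : LineCA n) (G : Grid) : GridCA G (n + 1) where
  rule s c := if h : ∃ s', Active A s c s' then h.choose else s

theorem fill_eq_last {n : ℕ} (x y : Fin n) (a : Fin 4) : fill x y a = Fin.last n ↔ a = 3 := by
  have h0 : (0 : Fin (n + 1)) ≠ Fin.last n := by
    have := x.pos
    rw [Ne, Fin.ext_iff]
    simp
    omega
  fin_cases a <;> simp [fill, h0, Fin.castSucc_ne_last]

theorem Grid.left_ne_right (G : Grid) : G.left ≠ G.right := by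
  cases G <;> decide

theorem applies_comp {n : ℕ} {x y : Fin n} {L : Labelling G} {μ : Equiv.Perm (Fin G.faces)}
    (hμ : μ ∈ G.rotations) (h : Applies L x y) : Applies (L ∘ μ) x y := by
  rcases h with ⟨ρ, hρ, rfl⟩ | ⟨⟨hG, ρ, hρ, h⟩, hxy⟩
  · exact Or.inl ⟨ρ * μ, mul_mem hρ hμ, rfl⟩
  · refine Or.inr ⟨⟨hG, ρ * μ, mul_mem hρ hμ, ?_⟩, hxy⟩
    rcases h with rfl | rfl
    · exact Or.inl rfl
    · exact Or.inr rfl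

theorem active_comp {n : ℕ} {A : LineCA n} {s s' : Fin (n + 1)} {c : Fin G.faces → Fin (n + 1)}
    {μ : Equiv.Perm (Fin G.faces)} (hμ : μ ∈ G.rotations) (h : Active A s c s') :
    Active A s (c ∘ μ) s' := by
  obtain ⟨x, s₀, y, L, hL, hs, rfl, hs'⟩ := h
  exact ⟨x, s₀, y, L ∘ μ, applies_comp hμ hL, hs, rfl, hs'⟩

theorem active_comp_iff {n : ℕ} {A : LineCA n} {s s' : Fin (n + 1)}
    {c : Fin G.faces → Fin (n + 1)} {μ : Equiv.Perm (Fin G.faces)} (hμ : μ ∈ G.rotations) :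
    Active A s (c ∘ μ) s' ↔ Active A s c s' := by
  refine ⟨fun h => ?_, active_comp hμ⟩
  have := active_comp (inv_mem hμ) h
  rwa [Function.comp_assoc, ← Equiv.Perm.coe_mul, mul_inv_cancel, Equiv.Perm.coe_one,
    Function.comp_id] at this

/-- An active context is seen in some way as the context of a cell of a line, with two distinct
neighbours on the line. -/
theorem Applies.exists_faces {n : ℕ} {x y : Fin n} {L : Labelling G} (h : Applies L x y) :
    ∃ i j, i ≠ j ∧ L i ≠ 3 ∧ L j ≠ 3 := by
  have hlr := G.left_ne_right
  have key : ∀ (μ : Equiv.Perm (Fin G.faces)) (M : Set (Fin G.faces)),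
      G.label M (μ (μ.symm G.left)) = 0 ∧ G.label M (μ (μ.symm G.right)) = 1 := fun μ M => by
    simp [Grid.label, hlr.symm]
  rcases h with ⟨μ, -, rfl⟩ | ⟨⟨-, μ, -, rfl | rfl⟩, -⟩
  all_goals
    refine ⟨μ.symm G.left, μ.symm G.right, fun h => hlr (μ.symm.injective h), ?_, ?_⟩
    all_goals simp only [Function.comp_apply, key]; decide

/-- In an active context, the states of the neighbours on the line are determined. -/
def Grid.Readable (G : Grid) : Prop :=
  ∀ {n : ℕ} {x y x' y' : Fin n} {L L' : Labelling G}, Applies L x y → Applies L' x' y' →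
    fill x y ∘ L = fill x' y' ∘ L' → x = x' ∧ y = y'

theorem Active.unique (hG : G.Readable) {n : ℕ} {A : LineCA n} {s s' s'' : Fin (n + 1)}
    {c : Fin G.faces → Fin (n + 1)} (h : Active A s c s') (h' : Active A s c s'') : s' = s'' := by
  obtain ⟨x, s₀, y, L, hL, rfl, rfl, rfl⟩ := h
  obtain ⟨x', s₀', y', L', hL', hs, hc, rfl⟩ := h'
  obtain ⟨rfl, rfl⟩ := hG hL hL' hc
  rw [Fin.castSucc_injective _ hs]

theorem LineCA.toGrid_rule_of_active (hG : G.Readable) {n : ℕ} {A : LineCA n}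
    {s s' : Fin (n + 1)} {c : Fin G.faces → Fin (n + 1)} (h : Active A s c s') :
    (A.toGrid G).rule s c = s' := by
  have hex : ∃ s', Active A s c s' := ⟨s', h⟩
  exact (dif_pos hex).trans (hex.choose_spec.unique hG h)

theorem LineCA.toGrid_rule_of_not_active {n : ℕ} {A : LineCA n}
    {s : Fin (n + 1)} {c : Fin G.faces → Fin (n + 1)} (h : ∀ s', ¬Active A s c s') :
    (A.toGrid G).rule s c = s :=
  dif_neg (not_exists.mpr h)

theorem LineCA.toGrid_rule_last {n : ℕ} {A : LineCA n} {c : Fin G.faces → Fin (n + 1)} :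
    (A.toGrid G).rule (Fin.last n) c = Fin.last n := by
  refine LineCA.toGrid_rule_of_not_active fun s' h => ?_
  obtain ⟨x, s₀, y, L, hL, hs, -⟩ := h
  exact Fin.castSucc_ne_last _ hs.symm

theorem LineCA.toGrid_rotationInvariant (hG : G.Readable) {n : ℕ} (A : LineCA n) :
    (A.toGrid G).RotationInvariant := by
  intro g hg μ hμ s c
  have hmem : μ ∈ G.rotations := ⟨g, hg, hμ⟩
  by_cases h : ∃ s', Active A s c s'
  · obtain ⟨s', h⟩ := h
    rw [LineCA.toGrid_rule_of_active hG h]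
    exact LineCA.toGrid_rule_of_active hG (active_comp hmem h)
  · rw [not_exists] at h
    rw [LineCA.toGrid_rule_of_not_active h]
    exact LineCA.toGrid_rule_of_not_active fun s' h' => h s' ((active_comp_iff hmem).mp h')

end Labels

/-! ### The simulation -/

/-- Rotation invariance allows the numbering of each tile to be replaced by any placement, in
particular by the one of the line. -/
theorem GridCA.step_eq {G : Grid} {m : ℕ} {B : GridCA G m} (hB : B.RotationInvariant)
    (hinj : Function.Injective G.normal) (ν : Numbering G) (c : Tile G → Fin m) {T : Tile G}
    (P : Placement T) : B.step ν c T = B.rule (c T) fun i => c (P.neighbour i) := by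
  obtain ⟨μ, ⟨g, hg, hgμ⟩, hμ⟩ := exists_rotation hinj (ν T) P
  have hn : ∀ i, P.neighbour i = (ν T).neighbour (μ i) := fun i => by
    apply Subtype.ext
    change reflection _ '' _ = reflection _ '' _
    rw [hμ]
  simp only [hn]
  exact (hB g hg μ hgμ (c T) fun i => c ((ν T).neighbour i)).symm

/-- The metric properties of the marked cells: a cell of the line sees no marked cell of another
cell of the line, the marked cells are off the line, and a marked cell sees at most one cell which
is marked or on the line. -/
structure Line.GoodMarks {G : Grid} (ℓ : Line G) (M : Set (Fin G.faces)) : Prop where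
  face_eq : ∀ k k' i, ∀ i' ∈ M, (ℓ.place k).neighbour i = (ℓ.place k').neighbour i' → i = i'
  subsingleton : ∀ k, ∀ i ∈ M, ∀ P : Placement ((ℓ.place k).neighbour i), ∀ j j',
    (∀ j₀, j₀ = j ∨ j₀ = j' → P.neighbour j₀ ∈ Set.range ℓ.tile ∨
      ∃ k', ∃ i' ∈ M, (ℓ.place k').neighbour i' = P.neighbour j₀) → j = j'

open Classical in
theorem Line.embed_off {G : Grid} (ℓ : Line G) {n : ℕ} (M : Set (Fin G.faces))
    (x : ℤ → Fin n) {T : Tile G} (hT : T ∉ Set.range ℓ.tile) : ℓ.embed M x T =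
      if ∃ k, ∃ i ∈ M, (ℓ.place k).neighbour i = T then 0 else Fin.last n :=
  Function.extend_apply' _ _ _ hT

namespace Grid.Geometry

variable {G : Grid} {s C : ℝ} {b : Mink G.dim}

theorem embed_tile (h : G.Geometry s C b) (ℓ : Line G) {n : ℕ} (M : Set (Fin G.faces))
    (x : ℤ → Fin n) (k : ℤ) : ℓ.embed M x (ℓ.tile k) = (x k).castSucc :=
  (h.tile_injective ℓ).extend_apply _ _ _

theorem embed_neighbour (h : G.Geometry s C b) (ℓ : Line G) {n : ℕ} {M : Set (Fin G.faces)}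
    (hM : ℓ.GoodMarks M) (x : ℤ → Fin n) (k : ℤ) (i : Fin G.faces) :
    ℓ.embed M x ((ℓ.place k).neighbour i) = fill (x (k - 1)) (x (k + 1)) (G.label M i) := by
  by_cases hl : i = G.left
  · rw [hl, h.neighbour_left, h.embed_tile]
    simp [fill, Grid.label]
  by_cases hr : i = G.right
  · rw [hr, h.neighbour_right, h.embed_tile]
    simp [fill, Grid.label, G.left_ne_right.symm]
  have hoff : (ℓ.place k).neighbour i ∉ Set.range ℓ.tile := by
    rintro ⟨j, hj⟩
    rcases h.neighbour_eq_tile ℓ hj.symm with h1 | h1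
    exacts [hl h1.1, hr h1.1]
  rw [ℓ.embed_off M x hoff]
  by_cases hi : i ∈ M
  · rw [if_pos ⟨k, i, hi, rfl⟩]
    simp [fill, Grid.label, hl, hr, hi]
  · rw [if_neg]
    · simp [fill, Grid.label, hl, hr, hi]
    · rintro ⟨k', i', hi', hn⟩
      rw [hM.face_eq k k' i i' hi' hn.symm] at hi
      exact hi hi'

/-- One step commutes with the embedding: a line cell is in an active context with the expected
outcome, a cell in the extra state never acts, and a marked cell sees too few non-extra states to
act. -/
theorem simulates (h : G.Geometry s C b) (hG : G.Readable) {n : ℕ} (A : LineCA n)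
    {M : Set (Fin G.faces)} (hM : ∀ ℓ : Line G, ℓ.GoodMarks M)
    (hA : ∀ x s₀ y, Active A s₀.castSucc (fill x y ∘ G.label M) (A.rule x s₀ y).castSucc) :
    (A.toGrid G).SimulatesOnLines A M := by
  intro ν ℓ x t
  have hstep : Function.Semiconj (ℓ.embed (n := n) M) A.step ((A.toGrid G).step ν) := by
    intro x
    funext T
    have hB := LineCA.toGrid_rotationInvariant hG A
    by_cases hT : T ∈ Set.range ℓ.tile
    · obtain ⟨k, rfl⟩ := hT
      rw [GridCA.step_eq hB h.injective ν _ (ℓ.place k), h.embed_tile, h.embed_tile]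
      simp only [h.embed_neighbour ℓ (hM ℓ)]
      exact (LineCA.toGrid_rule_of_active hG (hA _ _ _)).symm
    · rw [ℓ.embed_off M _ hT, GridCA.step, ℓ.embed_off M x hT]
      by_cases hm : ∃ k, ∃ i ∈ M, (ℓ.place k).neighbour i = T
      · rw [if_pos hm]
        refine (LineCA.toGrid_rule_of_not_active fun s' hact => ?_).symm
        obtain ⟨k, i, hi, rfl⟩ := hm
        obtain ⟨x', s₀, y', L, hL, -, hc, -⟩ := hact
        obtain ⟨j, j', hjj, hj, hj'⟩ := hL.exists_faces
        -- An active context would show two faces with a non-extra state, hence two neighbours on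
        -- the line or marked, against `GoodMarks.subsingleton`.
        refine hjj ((hM ℓ).subsingleton k i hi (ν _) j j' fun j₀ hj₀ => ?_)
        have h3 : L j₀ ≠ 3 := by
          rcases hj₀ with rfl | rfl
          exacts [hj, hj']
        by_contra! hcon
        refine h3 ((fill_eq_last x' y' _).mp ?_)
        have := congrFun hc j₀
        rw [Function.comp_apply, ℓ.embed_off M x hcon.1, if_neg] at this
        · exact this.symm
        · rintro ⟨k', i', hi', hn⟩
          exact hcon.2 k' i' hi' hn
      · rw [if_neg hm, LineCA.toGrid_rule_last]
  exact ((hstep.iterate_right t).eq x).symm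

end Grid.Geometry

theorem Line.goodMarks_empty {G : Grid} (ℓ : Line G) : ℓ.GoodMarks ∅ where
  face_eq _ _ _ _ h := h.elim
  subsingleton _ _ h := h.elim

theorem active_label_marks {G : Grid} {n : ℕ} (A : LineCA n) (x s₀ y : Fin n) :
    Active A s₀.castSucc (fill x y ∘ G.label G.marks) (A.rule x s₀ y).castSucc :=
  ⟨x, s₀, y, G.label G.marks, Or.inl ⟨1, one_mem _, rfl⟩, rfl, rfl, rfl⟩

theorem active_label_empty {n : ℕ} {A : LineCA n} (hA : A.Symmetric) (x s₀ y : Fin n) :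
    Active A s₀.castSucc (fill x y ∘ Grid.dodecagrid.label ∅) (A.rule x s₀ y).castSucc := by
  rcases le_total x y with hxy | hxy
  -- When the states are in the wrong order, the reversed labelling gives the same context, and
  -- symmetry of the rule the same result. Having the swapped labelling in the table avoids
  -- exhibiting the half-turn.
  · exact ⟨x, s₀, y, _, Or.inr ⟨⟨rfl, 1, one_mem _, Or.inl rfl⟩, hxy⟩, rfl, rfl, rfl⟩
  · refine ⟨y, s₀, x, _, Or.inr ⟨⟨rfl, 1, one_mem _, Or.inr rfl⟩, hxy⟩, rfl, ?_, by rw [hA]⟩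
    rw [← Function.comp_assoc]
    change _ = (fill y x ∘ Equiv.swap 0 1) ∘ Grid.dodecagrid.label ∅
    congr 1
    funext a
    fin_cases a <;> simp [fill, Equiv.swap_apply_def]

theorem goodMarks_dodecagrid {s φ : ℝ} {b : Mink 3} (h : Grid.dodecagrid.Geometry s φ b)
    (hφ : φ ^ 2 = φ + 1) (hs : 2 * s ^ 2 = φ)
    (h3 : dodecahedronNormal 3 =
      dodecahedronNormal 1 + φ • dodecahedronNormal 4 - φ • dodecahedronNormal 5)
    (ℓ : Line .dodecagrid) : ℓ.GoodMarks Grid.dodecagrid.marks := by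
  obtain ⟨h1, h2⟩ := eq_of_mink_markCentre h hφ hs h3 ℓ
  have hmark : ∀ i ∈ Grid.dodecagrid.marks, i = (3 : Fin 12) := fun i hi => hi
  refine ⟨fun k k' i i' hi' hn => ?_, fun k i hi P j j' hj => ?_⟩
  · have e := h.origin_add_eq_of_neighbours hn
    have e2 := h.mink_origin_add (ℓ.place k) i
    rw [hmark i' hi'] at e hn
    rw [e] at e2
    have hk := h1 k k' e2
    subst hk
    rw [hmark i' hi']
    exact h.neighbour_injective _ hn
  · obtain rfl := hmark i hi
    have ho : ℓ.markCentre s k = P.motion (origin 3) :=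
      h.origin_add_eq_of_neighbour (P := ℓ.place k) (P' := P) (i := (3 : Fin 12)) rfl
    -- Any cell on the line or marked that is adjacent to the mark of cell `k` is cell `k` itself.
    have key : ∀ j₀, j₀ = j ∨ j₀ = j' → P.neighbour j₀ = ℓ.tile k := by
      intro j₀ hj₀
      have e2 := h.mink_origin_add P j₀
      rcases hj j₀ hj₀ with ⟨k', hk'⟩ | ⟨k', i', hi', hk'⟩
      · rw [h.origin_add_eq_of_neighbour (P' := ℓ.place k') hk'.symm, mink_comm] at e2
        change mink (ℓ.centre k') (P.motion (origin 3)) = _ at e2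
        rw [← ho] at e2
        rw [← hk', h1 k' k e2]
      · obtain rfl := hmark i' hi'
        rw [h.origin_add_eq_of_neighbours hk'.symm] at e2
        change mink (P.motion (origin 3)) (ℓ.markCentre s k') = _ at e2
        rw [← ho] at e2
        exact absurd e2 (h2 _ _)
    exact h.neighbour_injective P ((key j (Or.inl rfl)).trans (key j' (Or.inr rfl)).symm)

/-! ### Reading the contexts of the cells of a line -/

/-- A rotation exchanging the two faces fixes the centre, and in the plane these three vectors span.
It would therefore coincide with the mirror `b`, whose determinant is `-1`. -/
theorem Grid.Geometry.not_swap {G : Grid} {s C : ℝ} {b : Mink G.dim} (h : G.Geometry s C b)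
    (hspan : ∀ y : Mink G.dim, ∃ α β γ : ℝ,
      y = α • origin G.dim + β • G.normal G.left + γ • G.normal G.right)
    {μ : Equiv.Perm (Fin G.faces)} (hμ : μ ∈ G.rotations) (hl : μ G.left = G.right)
    (hr : μ G.right = G.left) : False := by
  obtain ⟨g, hg, hgμ⟩ := hμ
  have ho := h.map_origin_of_rotation hgμ
  have hgl := hgμ G.left
  have hgr := hgμ G.right
  rw [hl] at hgl
  rw [hr] at hgr
  have hbr : reflection b (G.normal G.right) = G.normal G.left := by
    rw [← h.mirror_left, reflection_reflection h.mirror_norm]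
  have : g = reflectionEquiv b h.mirror_norm := by
    refine LinearEquiv.ext fun y => ?_
    obtain ⟨α, β, γ, rfl⟩ := hspan y
    simp only [map_add, map_smul, ho, hgl, hgr, reflectionEquiv_apply, h.mirror_origin,
      h.mirror_left, hbr]
  have hdet := hg.2.2
  rw [this, det_reflectionEquiv, ← Units.val_inj] at hdet
  norm_num at hdet

theorem span_pentagrid (y : Mink 2) : ∃ α β γ : ℝ,
    y = α • origin 2 + β • polygonNormal 5 4 1 + γ • polygonNormal 5 4 4 := by
  have hpi := Real.pi_pos
  have hσ : 0 < Real.sin (2 * Real.pi / 5) :=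
    Real.sin_pos_of_pos_of_lt_pi (by linarith) (by linarith)
  have hk := cos_two_pi_div_five_pos
  have hc : 0 < polygonCosh 5 4 := by linarith [one_lt_polygonCosh_pentagrid]
  rw [polygonNormal_pentagrid_one, polygonNormal_pentagrid_four, origin_two]
  set s := polygonSinh 5 4
  set c := polygonCosh 5 4
  set k := Real.cos (2 * Real.pi / 5)
  set σ := Real.sin (2 * Real.pi / 5)
  refine ⟨y 0 - s * y 1 / (c * k), (y 1 / (c * k) - y 2 / (c * σ)) / 2,
    (y 1 / (c * k) + y 2 / (c * σ)) / 2, mink_two_ext ?_ ?_ ?_⟩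
  · simp; field_simp; ring
  · simp; field_simp; ring
  · simp; field_simp; ring

theorem span_heptagrid (y : Mink 2) : ∃ α β γ : ℝ,
    y = α • origin 2 + β • polygonNormal 7 3 1 + γ • polygonNormal 7 3 5 := by
  have hpi := Real.pi_pos
  have hσ : 0 < Real.sin (3 * (Real.pi / 7)) :=
    Real.sin_pos_of_pos_of_lt_pi (by linarith) (by linarith)
  have hk : 0 < Real.cos (3 * (Real.pi / 7)) :=
    Real.cos_pos_of_mem_Ioo ⟨by linarith, by linarith⟩
  have hSK := Real.sin_sq_add_cos_sq (Real.pi / 7)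
  have hc : 0 < polygonCosh 7 3 := by linarith [one_lt_polygonCosh_heptagrid]
  rw [polygonNormal_heptagrid_one, polygonNormal_heptagrid_five, origin_two]
  set s := polygonSinh 7 3
  set c := polygonCosh 7 3
  set K := Real.cos (Real.pi / 7)
  set S := Real.sin (Real.pi / 7)
  set k := Real.cos (3 * (Real.pi / 7))
  set σ := Real.sin (3 * (Real.pi / 7))
  refine ⟨y 0 - s * (K * y 1 + S * y 2) / (c * k),
    ((K * y 1 + S * y 2) / (c * k) - (K * y 2 - S * y 1) / (c * σ)) / 2,
    ((K * y 1 + S * y 2) / (c * k) + (K * y 2 - S * y 1) / (c * σ)) / 2, mink_two_ext ?_ ?_ ?_⟩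
  · simp; field_simp; ring
  · simp; field_simp
    linear_combination (-2 * k * σ * y 1) * hSK
  · simp; field_simp
    linear_combination (-2 * k * σ * y 2) * hSK

/-- The labelling with the labels `0` and `1` on the faces `a` and `b`. -/
def labelPair {m : ℕ} (a b i : Fin m) : Fin 4 := if i = a then 0 else if i = b then 1 else 3

/-- The labelling with the labels `0`, `1` and `2` on the faces `a`, `b` and `e`. -/
def labelTriple {m : ℕ} (a b e i : Fin m) : Fin 4 :=
  if i = a then 0 else if i = b then 1 else if i = e then 2 else 3

theorem label_empty_comp {G : Grid} (μ : Equiv.Perm (Fin G.faces)) :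
    G.label ∅ ∘ μ = labelPair (μ.symm G.left) (μ.symm G.right) := by
  funext i
  simp [Grid.label, labelPair, Equiv.eq_symm_apply]

theorem fill_zero {n : ℕ} (x y : Fin n) : fill x y 0 = x.castSucc := rfl

theorem fill_one {n : ℕ} (x y : Fin n) : fill x y 1 = y.castSucc := rfl

theorem fill_two {n : ℕ} (x y : Fin n) : fill x y 2 = 0 := rfl

theorem fill_three {n : ℕ} (x y : Fin n) : fill x y 3 = Fin.last n := rfl

/-- The faces not showing the extra state are exactly the two labelled ones, so both readings use
the same pair of faces, up to order. -/
theorem fill_labelPair {n m : ℕ} {x y x' y' : Fin n} {a b a' b' : Fin m} (hab : a ≠ b)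
    (hab' : a' ≠ b') (h : fill x y ∘ labelPair a b = fill x' y' ∘ labelPair a' b') :
    a = a' ∧ b = b' ∧ x = x' ∧ y = y' ∨ a = b' ∧ b = a' ∧ x = y' ∧ y = x' := by
  have h1 := fun i => congrFun h i
  simp only [Function.comp_apply, labelPair] at h1
  have e0 := fun x y : Fin n => fill_zero x y
  have e1 := fun x y : Fin n => fill_one x y
  have e3 := fun x y : Fin n => fill_three x y
  have hne := fun x : Fin n => Fin.castSucc_ne_last x
  have hinj := fun x y : Fin n => (Fin.castSucc_inj (a := x) (b := y)).mp
  have := h1 a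
  have := h1 b
  have := h1 a'
  have := h1 b'
  grind

theorem Grid.Geometry.readable_plane {G : Grid} {s C : ℝ} {b : Mink G.dim}
    (h : G.Geometry s C b) (hG : G ≠ .dodecagrid)
    (hspan : ∀ y : Mink G.dim, ∃ α β γ : ℝ,
      y = α • origin G.dim + β • G.normal G.left + γ • G.normal G.right) : G.Readable := by
  intro n x y x' y' L L' hL hL' hfill
  have hM : G.marks = ∅ := by cases G <;> first | rfl | exact absurd rfl hG
  rcases hL with ⟨μ, hμ, rfl⟩ | ⟨⟨hG', -⟩, -⟩
  swap
  · exact absurd hG' hG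
  rcases hL' with ⟨μ', hμ', rfl⟩ | ⟨⟨hG', -⟩, -⟩
  swap
  · exact absurd hG' hG
  rw [hM, label_empty_comp, label_empty_comp] at hfill
  have hlr := G.left_ne_right
  rcases fill_labelPair (μ.symm.injective.ne hlr) (μ'.symm.injective.ne hlr) hfill with
    ⟨-, -, h1⟩ | ⟨h1, h2, -⟩
  · exact h1
  · exfalso
    -- Two readings in opposite orders differ by the rotation `μ' * μ⁻¹`, which exchanges left and
    -- right.
    refine h.not_swap hspan (mul_mem hμ' (inv_mem hμ)) ?_ ?_
    · change μ' (μ.symm _) = _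
      rw [h1, Equiv.apply_symm_apply]
    · change μ' (μ.symm _) = _
      rw [h2, Equiv.apply_symm_apply]

/-- Both readings use the same three faces, and `a` is the only one having product `p` with the two
others, so `a = a'` and `x = x'`. The faces `b` and `e` may be exchanged between the readings, but
then `y` and `y'` both equal the mark state `0`, so there is still no ambiguity. -/
theorem fill_labelTriple {n m : ℕ} {x y x' y' : Fin n} {a b e a' b' e' : Fin m}
    {g : Fin m → Fin m → ℝ} {p : ℝ} (hp : p ≠ 0) (hg1 : ∀ i, g i i = 1) (hp1 : p ≠ 1)
    (hg : ∀ i j, g i j = g j i) (hab : g a b = p) (hae : g a e = p) (hbe : g b e = 0)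
    (hab' : g a' b' = p) (hae' : g a' e' = p) (hbe' : g b' e' = 0)
    (h : fill x y ∘ labelTriple a b e = fill x' y' ∘ labelTriple a' b' e') :
    x = x' ∧ y = y' := by
  have n1 : a ≠ b := by rintro rfl; exact hp1 (hab.symm.trans (hg1 _))
  have n2 : a ≠ e := by rintro rfl; exact hp1 (hae.symm.trans (hg1 _))
  have n3 : b ≠ e := by rintro rfl; exact zero_ne_one (hbe.symm.trans (hg1 _))
  have n1' : a' ≠ b' := by rintro rfl; exact hp1 (hab'.symm.trans (hg1 _))
  have n2' : a' ≠ e' := by rintro rfl; exact hp1 (hae'.symm.trans (hg1 _))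
  have n3' : b' ≠ e' := by rintro rfl; exact zero_ne_one (hbe'.symm.trans (hg1 _))
  have hz : (0 : Fin (n + 1)) ≠ Fin.last n := by
    have := (fill_eq_last x y 2).not.mpr (by decide)
    rwa [fill_two] at this
  have h1 := fun i => congrFun h i
  simp only [Function.comp_apply, labelTriple] at h1
  have e0 := fun x y : Fin n => fill_zero x y
  have e1 := fun x y : Fin n => fill_one x y
  have e2 := fun x y : Fin n => fill_two x y
  have e3 := fun x y : Fin n => fill_three x y
  have hne := fun x : Fin n => Fin.castSucc_ne_last x
  have hinj := fun x y : Fin n => (Fin.castSucc_inj (a := x) (b := y)).mp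
  have ka := h1 a
  have kb := h1 b
  have ke := h1 e
  have ka' := h1 a'
  have kb' := h1 b'
  have ke' := h1 e'
  have g1 := hg a b
  have g2 := hg a e
  have g3 := hg b e
  have g1' := hg a' b'
  have g2' := hg a' e'
  have g3' := hg b' e'
  clear h h1 hg hg1
  grind

/-- Three faces with a non-extra state cannot be matched with two: marked and unmarked contexts
never collide. -/
theorem fill_labelTriple_ne {n m : ℕ} {x y x' y' : Fin n} {a b e a' b' : Fin m} (n1 : a ≠ b)
    (n2 : a ≠ e) (n3 : b ≠ e) :
    fill x y ∘ labelTriple a b e ≠ fill x' y' ∘ labelPair a' b' := by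
  intro h
  have hz : (0 : Fin (n + 1)) ≠ Fin.last n := by
    have := (fill_eq_last x y 2).not.mpr (by decide)
    rwa [fill_two] at this
  have h1 := fun i => congrFun h i
  simp only [Function.comp_apply, labelTriple, labelPair] at h1
  have e0 := fun x y : Fin n => fill_zero x y
  have e1 := fun x y : Fin n => fill_one x y
  have e2 := fun x y : Fin n => fill_two x y
  have e3 := fun x y : Fin n => fill_three x y
  have hne := fun x : Fin n => Fin.castSucc_ne_last x
  have ka := h1 a
  have kb := h1 b
  have ke := h1 e
  clear h h1
  grind

theorem label_marks_comp_dodecagrid (μ : Equiv.Perm (Fin 12)) :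
    Grid.dodecagrid.label Grid.dodecagrid.marks ∘ μ =
      labelTriple (μ.symm 1) (μ.symm 4) (μ.symm 3) := by
  funext i
  simp only [Function.comp_apply, Grid.label, labelTriple, Equiv.eq_symm_apply]
  refine if_congr Iff.rfl rfl (if_congr Iff.rfl rfl ?_)
  by_cases h : μ i = 3
  · rw [if_pos h]
    exact if_pos h
  · rw [if_neg h]
    exact if_neg h

theorem swap_labelPair {m : ℕ} {a b : Fin m} (hab : a ≠ b) :
    Equiv.swap 0 1 ∘ labelPair a b = labelPair b a := by
  funext i
  simp only [Function.comp_apply, labelPair]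
  split_ifs with h1 h2
  · exact absurd (h1.symm.trans h2) hab
  all_goals decide

theorem undirectedLabellings_eq_labelPair {G : Grid} {L : Labelling G}
    (h : L ∈ G.undirectedLabellings) : ∃ a b, a ≠ b ∧ L = labelPair a b := by
  obtain ⟨-, μ, -, h⟩ := h
  have hne := μ.symm.injective.ne G.left_ne_right
  rw [label_empty_comp, swap_labelPair hne] at h
  rcases h with rfl | rfl
  exacts [⟨_, _, hne, rfl⟩, ⟨_, _, hne.symm, rfl⟩]

/-- Rotations preserve the products of normals, so it suffices to compute them for faces `1`, `4`,
`3`: value `0` for the adjacent faces `4` and `3`, and `-φ` for the pairs containing `1`. -/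
theorem labellings_dodecagrid {s φ : ℝ} {b : Mink 3} (h : Grid.dodecagrid.Geometry s φ b)
    (hφ : φ ^ 2 = φ + 1)
    (h3 : dodecahedronNormal 3 =
      dodecahedronNormal 1 + φ • dodecahedronNormal 4 - φ • dodecahedronNormal 5)
    {L : Labelling .dodecagrid} (hL : L ∈ Grid.dodecagrid.labellings) :
    ∃ i j k : Fin 12, mink (dodecahedronNormal i) (dodecahedronNormal j) = -φ ∧
      mink (dodecahedronNormal i) (dodecahedronNormal k) = -φ ∧
      mink (dodecahedronNormal j) (dodecahedronNormal k) = 0 ∧ L = labelTriple i j k := by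
  obtain ⟨μ, hμ, rfl⟩ := hL
  have hrot : ∀ i j, mink (dodecahedronNormal (μ.symm i)) (dodecahedronNormal (μ.symm j)) =
      mink (dodecahedronNormal i) (dodecahedronNormal j) := fun i j =>
    Grid.Geometry.rotation_mink (inv_mem hμ) i j
  have h14 : mink (dodecahedronNormal 1) (dodecahedronNormal 4) = -φ := h.left_right
  have h51 : mink (dodecahedronNormal 5) (dodecahedronNormal 1) = 0 := h.guide_left _ (Or.inr rfl)
  have h54 : mink (dodecahedronNormal 5) (dodecahedronNormal 4) = 0 := h.guide_right _ (Or.inr rfl)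
  have h11 : mink (dodecahedronNormal 1) (dodecahedronNormal 1) = 1 := h.norm 1
  have h44 : mink (dodecahedronNormal 4) (dodecahedronNormal 4) = 1 := h.norm 4
  refine ⟨μ.symm 1, μ.symm 4, μ.symm 3, ?_, ?_, ?_, label_marks_comp_dodecagrid μ⟩
  · rw [hrot, h14]
  · rw [hrot, h3, mink_sub_right, mink_add_right, mink_smul_right, mink_smul_right, h11, h14,
      mink_comm _ (dodecahedronNormal 5), h51]
    linear_combination (-1) * hφ
  · rw [hrot, h3, mink_sub_right, mink_add_right, mink_smul_right, mink_smul_right, h44,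
      mink_comm _ (dodecahedronNormal 1), h14, mink_comm _ (dodecahedronNormal 5), h54]
    ring

theorem readable_dodecagrid {s φ : ℝ} {b : Mink 3} (h : Grid.dodecagrid.Geometry s φ b)
    (hφ : φ ^ 2 = φ + 1)
    (h3 : dodecahedronNormal 3 =
      dodecahedronNormal 1 + φ • dodecahedronNormal 4 - φ • dodecahedronNormal 5) :
    Grid.dodecagrid.Readable := by
  have hφ1 := h.one_lt
  have hn := h.norm
  have key : ∀ {n : ℕ} {x y x' y' : Fin n} {L L' : Labelling .dodecagrid},
      L ∈ Grid.dodecagrid.labellings → L' ∈ Grid.dodecagrid.undirectedLabellings →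
      fill x y ∘ L ≠ fill x' y' ∘ L' := by
    intro n x y x' y' L L' hL hL'
    obtain ⟨i, j, k, hij, hik, hjk, rfl⟩ := labellings_dodecagrid h hφ h3 hL
    obtain ⟨a', b', -, rfl⟩ := undirectedLabellings_eq_labelPair hL'
    apply fill_labelTriple_ne
    · rintro rfl
      linarith [hij.symm.trans (hn i)]
    · rintro rfl
      linarith [hik.symm.trans (hn i)]
    · rintro rfl
      exact zero_ne_one (hjk.symm.trans (hn j))
  intro n x y x' y' L L' hL hL' hfill
  rcases hL with hL | ⟨hL, hxy⟩ <;> rcases hL' with hL' | ⟨hL', hxy'⟩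
  · obtain ⟨i, j, k, hij, hik, hjk, rfl⟩ := labellings_dodecagrid h hφ h3 hL
    obtain ⟨i', j', k', hij', hik', hjk', rfl⟩ := labellings_dodecagrid h hφ h3 hL'
    exact fill_labelTriple (g := fun i j => mink (dodecahedronNormal i) (dodecahedronNormal j))
      (by linarith : -φ ≠ 0) hn (by linarith) (fun i j => mink_comm _ _) hij hik hjk hij' hik' hjk'
      hfill
  · exact absurd hfill (key hL hL')
  · exact absurd hfill.symm (key hL' hL)
  · obtain ⟨i, j, hij, rfl⟩ := undirectedLabellings_eq_labelPair hL
    obtain ⟨i', j', hij', rfl⟩ := undirectedLabellings_eq_labelPair hL'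
    rcases fill_labelPair hij hij' hfill with ⟨-, -, h1⟩ | ⟨-, -, rfl, rfl⟩
    · exact h1
    · have := le_antisymm hxy hxy'
      exact ⟨this, this.symm⟩

/-! ### The algorithm -/

/-- The words of length `k` over `{0, …, m - 1}`. -/
def words (m : ℕ) : ℕ → List (List ℕ)
  | 0 => [[]]
  | k + 1 => (List.range m).flatMap fun a => (words m k).map (a :: ·)

theorem mem_words {m k : ℕ} {w : List ℕ} :
    w ∈ words m k ↔ ∃ c : Fin k → Fin m, w = List.ofFn fun i => (c i).val := by
  induction k generalizing w with
  | zero =>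
    simp only [words, List.mem_singleton, List.ofFn_zero]
    exact ⟨fun h => ⟨Fin.elim0, h⟩, fun ⟨_, h⟩ => h⟩
  | succ k ih =>
    simp only [words, List.mem_flatMap, List.mem_range, List.mem_map, ih]
    constructor
    · rintro ⟨a, ha, _, ⟨c, rfl⟩, rfl⟩
      exact ⟨Fin.cons ⟨a, ha⟩ c, by simp [List.ofFn_succ]⟩
    · rintro ⟨c, rfl⟩
      exact ⟨c 0, (c 0).2, _, ⟨fun i => c i.succ, rfl⟩, by simp [List.ofFn_succ]⟩

theorem primrec_words (k : ℕ) : Primrec fun m => words m k := by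
  induction k with
  | zero => exact Primrec.const _
  | succ k ih =>
    refine Primrec.list_flatMap Primrec.list_range ?_
    refine Primrec.list_map (ih.comp Primrec.fst) ?_
    exact Primrec.list_cons.comp (Primrec.snd.comp Primrec.fst) Primrec.snd

/-- A list of the labellings of a set, as words. -/
def codes {G : Grid} (S : Set (Labelling G)) : List (List ℕ) :=
  S.toFinite.toFinset.toList.map fun L => List.ofFn fun i => (L i).val

theorem mem_codes {G : Grid} {S : Set (Labelling G)} {u : List ℕ} :
    u ∈ codes S ↔ ∃ L ∈ S, u = List.ofFn fun i => (L i).val := by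
  simp [codes, eq_comm]

/-- The state which is seen through a face with a given label, as a number. -/
def fillNat (n x y a : ℕ) : ℕ := if a = 0 then x else if a = 1 then y else if a = 2 then 0 else n

/-- The active contexts which a rule of a one-dimensional automaton with `n` states gives rise to
by means of the labelling `u`, with the new state. -/
def activeWord (n : ℕ) (r u : List ℕ) : List ℕ × ℕ :=
  -- A rule `x s y s'` has its current state at index `1`, while a grid rule begins with it. The
  -- default `0` only concerns words shorter than four letters, which do not occur in a code.
  (r.getD 1 0 :: u.map (fillNat n (r.getD 0 0) (r.getD 2 0)), r.getD 3 0)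

/-- The list of the active contexts of the automaton on the grid, with the new states. -/
def activeWords (G : Grid) (p : Code) : List (List ℕ × ℕ) :=
  p.2.flatMap fun r => (codes G.labellings).map (activeWord p.1 r) ++
    if r.getD 0 0 ≤ r.getD 2 0 then (codes G.undirectedLabellings).map (activeWord p.1 r) else []

/-- The contexts in which a cell keeps its state. -/
def passiveWords (G : Grid) (p : Code) : List (List ℕ) :=
  (words (p.1 + 1) (G.faces + 1)).filter fun w => ∀ a ∈ activeWords G p, a.1 ≠ w

/-- The algorithm which transforms a one-dimensional automaton into an automaton on the grid. -/
def compile (G : Grid) (p : Code) : Code :=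
  (p.1 + 1, ((activeWords G p).map fun a => a.1 ++ [a.2]) ++
    (passiveWords G p).map fun w => w ++ [w.headI])

theorem primrec_fillNat : Primrec fun q : (ℕ × ℕ × ℕ) × ℕ => fillNat q.1.1 q.1.2.1 q.1.2.2 q.2 := by
  have heq : ∀ k, PrimrecPred fun q : (ℕ × ℕ × ℕ) × ℕ => q.2 = k := fun k =>
    Primrec.eq.comp Primrec.snd (Primrec.const k)
  refine Primrec.ite (heq 0) (Primrec.fst.comp (Primrec.snd.comp Primrec.fst)) ?_
  refine Primrec.ite (heq 1) (Primrec.snd.comp (Primrec.snd.comp Primrec.fst)) ?_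
  exact Primrec.ite (heq 2) (Primrec.const 0) (Primrec.fst.comp Primrec.fst)

theorem primrec_activeWord :
    Primrec fun q : (ℕ × List ℕ) × List ℕ => activeWord q.1.1 q.1.2 q.2 := by
  have hget : ∀ k, Primrec fun q : (ℕ × List ℕ) × List ℕ => q.1.2.getD k 0 := fun k =>
    (Primrec.list_getD 0).comp (Primrec.snd.comp Primrec.fst) (Primrec.const k)
  refine Primrec.pair (Primrec.list_cons.comp (hget 1) ?_) (hget 3)
  refine Primrec.list_map Primrec.snd ?_
  exact primrec_fillNat.comp (Primrec.pair
    (Primrec.pair (Primrec.fst.comp (Primrec.fst.comp Primrec.fst))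
      (Primrec.pair ((hget 0).comp Primrec.fst) ((hget 2).comp Primrec.fst))) Primrec.snd)

/-- The tables of labellings do not depend on the input, so they enter as constants; that they are
chosen classically does not affect computability. -/
theorem primrec_activeWords (G : Grid) : Primrec (activeWords G) := by
  have hmap : ∀ l : List (List ℕ),
      Primrec fun q : Code × List ℕ => l.map (activeWord q.1.1 q.2) := fun l =>
    Primrec.list_map (Primrec.const l) (primrec_activeWord.comp (Primrec.pair
      (Primrec.pair (Primrec.fst.comp (Primrec.fst.comp Primrec.fst))
        (Primrec.snd.comp Primrec.fst)) Primrec.snd))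
  have hget : ∀ k, Primrec fun q : Code × List ℕ => q.2.getD k 0 := fun k =>
    (Primrec.list_getD 0).comp Primrec.snd (Primrec.const k)
  refine Primrec.list_flatMap Primrec.snd ?_
  refine Primrec.list_append.comp (hmap _) ?_
  exact Primrec.ite (Primrec.nat_le.comp (hget 0) (hget 2)) (hmap _) (Primrec.const _)

theorem primrec_passiveWords (G : Grid) : Primrec (passiveWords G) := by
  have hne : PrimrecRel fun (a : List ℕ × ℕ) (w : List ℕ) => a.1 ≠ w :=
    (Primrec.eq.comp (Primrec.fst.comp Primrec.fst) Primrec.snd).not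
  have hall : PrimrecRel fun (w : List ℕ) (p : Code) => ∀ a ∈ activeWords G p, a.1 ≠ w :=
    hne.forall_mem_list.comp ((primrec_activeWords G).comp Primrec.snd) Primrec.fst
  exact hall.listFilter.comp ((primrec_words _).comp (Primrec.succ.comp Primrec.fst)) Primrec.id

theorem computable_compile (G : Grid) : Computable (compile G) := by
  refine Primrec.to_comp (Primrec.pair (Primrec.succ.comp Primrec.fst) ?_)
  refine Primrec.list_append.comp (Primrec.list_map (primrec_activeWords G) ?_)
    (Primrec.list_map (primrec_passiveWords G) ?_)
  · exact Primrec.list_concat.comp (Primrec.fst.comp Primrec.snd) (Primrec.snd.comp Primrec.snd)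
  · exact Primrec.list_concat.comp Primrec.snd (Primrec.list_headI.comp Primrec.snd)

/-- A state and a context, as a word. -/
def contextWord {k m : ℕ} (s : Fin m) (c : Fin k → Fin m) : List ℕ :=
  s.val :: List.ofFn fun i => (c i).val

theorem contextWord_inj {k m : ℕ} {s s' : Fin m} {c c' : Fin k → Fin m} :
    contextWord s c = contextWord s' c' ↔ s = s' ∧ c = c' := by
  simp only [contextWord, List.cons.injEq, Fin.val_inj, List.ofFn_inj, funext_iff]

theorem activeWord_eq {G : Grid} {n : ℕ} (A : LineCA n) (x s y : Fin n) (L : Labelling G) :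
    activeWord n [x.val, s.val, y.val, (A.rule x s y).val] (List.ofFn fun i => (L i).val) =
      (contextWord s.castSucc (fill x y ∘ L), (A.rule x s y).castSucc.val) := by
  have hfill : ∀ a : Fin 4, fillNat n x y a = (fill x y a).val := by
    intro a
    fin_cases a <;> simp [fillNat, fill]
  simp only [activeWord, contextWord, List.map_ofFn, List.getD_cons_zero, List.getD_cons_succ]
  simp only [Function.comp_def, hfill, Fin.val_castSucc]

theorem mem_activeWords {G : Grid} {n : ℕ} {A : LineCA n} {p : Code} (hp : A.IsCode p)
    {a : List ℕ × ℕ} : a ∈ activeWords G p ↔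
      ∃ s c s', Active (G := G) A s c s' ∧ a = (contextWord s c, s'.val) := by
  obtain ⟨rfl, hp⟩ := hp
  simp only [activeWords, List.mem_flatMap, hp, List.mem_append, List.mem_map, mem_codes]
  constructor
  · rintro ⟨_, ⟨x, s, y, rfl⟩, ⟨_, ⟨L, hL, rfl⟩, rfl⟩ | h⟩
    · exact ⟨_, _, _, ⟨x, s, y, L, Or.inl hL, rfl, rfl, rfl⟩, activeWord_eq A x s y L⟩
    · split_ifs at h with hxy
      · simp only [List.mem_map, mem_codes] at h
        obtain ⟨_, ⟨L, hL, rfl⟩, rfl⟩ := h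
        exact ⟨_, _, _, ⟨x, s, y, L, Or.inr ⟨hL, hxy⟩, rfl, rfl, rfl⟩, activeWord_eq A x s y L⟩
      · simp at h
  · rintro ⟨_, _, _, ⟨x, s, y, L, hL | ⟨hL, hxy⟩, rfl, rfl, rfl⟩, rfl⟩
    · exact ⟨_, ⟨x, s, y, rfl⟩, Or.inl ⟨_, ⟨L, hL, rfl⟩, activeWord_eq A x s y L⟩⟩
    · refine ⟨_, ⟨x, s, y, rfl⟩, Or.inr ?_⟩
      rw [if_pos (by simpa using hxy)]
      exact List.mem_map.mpr ⟨_, mem_codes.mpr ⟨L, hL, rfl⟩, activeWord_eq A x s y L⟩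

theorem mem_passiveWords {G : Grid} {n : ℕ} {A : LineCA n} {p : Code} (hp : A.IsCode p)
    {w : List ℕ} : w ∈ passiveWords G p ↔
      ∃ s c, (∀ s', ¬Active (G := G) A s c s') ∧ w = contextWord s c := by
  simp only [passiveWords, List.mem_filter, mem_words, decide_eq_true_eq, mem_activeWords hp,
    hp.1]
  constructor
  · rintro ⟨⟨c, rfl⟩, h⟩
    refine ⟨c 0, fun i => c i.succ, fun s' hs' => ?_, by simp [contextWord, List.ofFn_succ]⟩
    exact h _ ⟨_, _, _, hs', rfl⟩ (by simp [contextWord, List.ofFn_succ])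
  · rintro ⟨s, c, h, rfl⟩
    refine ⟨⟨Fin.cons s c, by simp [contextWord, List.ofFn_succ]⟩, ?_⟩
    rintro _ ⟨s₁, c₁, s', h', rfl⟩ heq
    obtain ⟨rfl, rfl⟩ := contextWord_inj.mp heq
    exact h _ h'

/-- Every context is either active, with its unique outcome, or passive, in which case the new state
is the first letter of the word. -/
theorem isCode_compile {G : Grid} (hG : G.Readable) {n : ℕ} {A : LineCA n} {p : Code}
    (hp : A.IsCode p) : (A.toGrid G).IsCode (compile G p) := by
  refine ⟨by rw [compile, hp.1], fun w => ?_⟩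
  simp only [compile, List.mem_append, List.mem_map, mem_activeWords hp, mem_passiveWords hp]
  constructor
  · rintro (⟨_, ⟨s, c, s', h, rfl⟩, rfl⟩ | ⟨_, ⟨s, c, h, rfl⟩, rfl⟩)
    · exact ⟨s, c, by rw [LineCA.toGrid_rule_of_active hG h]; rfl⟩
    · exact ⟨s, c, by rw [LineCA.toGrid_rule_of_not_active h]; rfl⟩
  · rintro ⟨s, c, rfl⟩
    by_cases h : ∃ s', Active A s c s'
    · obtain ⟨s', h⟩ := h
      exact Or.inl ⟨_, ⟨s, c, s', h, rfl⟩, by rw [LineCA.toGrid_rule_of_active hG h]; rfl⟩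
    · rw [not_exists] at h
      exact Or.inr ⟨_, ⟨s, c, h, rfl⟩, by rw [LineCA.toGrid_rule_of_not_active h]; rfl⟩

/-- The properties of a grid which the construction relies on. -/
theorem grid_properties (G : Grid) : ∃ (s C : ℝ) (b : Mink G.dim), G.Geometry s C b ∧
    G.Readable ∧ (∀ ℓ : Line G, ℓ.GoodMarks G.marks) ∧ (G.marks = ∅ ∨ G = .dodecagrid) := by
  cases G with
  | pentagrid =>
    obtain ⟨C, h⟩ := geometry_pentagrid
    exact ⟨_, C, _, h, h.readable_plane (by simp) span_pentagrid, Line.goodMarks_empty,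
      Or.inl rfl⟩
  | heptagrid =>
    obtain ⟨C, h⟩ := geometry_heptagrid
    exact ⟨_, C, _, h, h.readable_plane (by simp) span_heptagrid, Line.goodMarks_empty,
      Or.inl rfl⟩
  | dodecagrid =>
    obtain ⟨s, φ, b, h, hφ, hs, h3⟩ := geometry_dodecagrid
    exact ⟨s, φ, b, h, readable_dodecagrid h hφ h3, goodMarks_dodecagrid h hφ hs h3,
      Or.inr rfl⟩

end HypCA

end

theorem theorem1 :
    (∀ G : HypCA.Grid, Nonempty (HypCA.Numbering G) ∧ Nonempty (HypCA.Line G) ∧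
      ∀ ℓ : HypCA.Line G, Function.Injective ℓ.tile) ∧
    ∃ f : HypCA.Grid → HypCA.Code → HypCA.Code,
      (∀ G : HypCA.Grid, Computable (f G)) ∧
      ∀ (n : ℕ) (A : HypCA.LineCA n) (p : HypCA.Code), A.IsCode p → ∀ G : HypCA.Grid,
        ∃ B : HypCA.GridCA G (n + 1),
          B.IsCode (f G p) ∧ B.RotationInvariant ∧
          B.SimulatesOnLines A G.marks ∧ (A.Symmetric → B.SimulatesOnLines A ∅) := by
  refine ⟨fun G => ?_, HypCA.compile, HypCA.computable_compile, fun n A p hp G => ?_⟩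
  · obtain ⟨s, C, b, h, -⟩ := HypCA.grid_properties G
    exact ⟨⟨fun T => (h.nonempty_placement T).some⟩, h.nonempty_line, h.tile_injective⟩
  · obtain ⟨s, C, b, h, hG, hM, hmarks⟩ := HypCA.grid_properties G
    have hsim := h.simulates hG A hM (HypCA.active_label_marks A)
    refine ⟨A.toGrid G, HypCA.isCode_compile hG hp, A.toGrid_rotationInvariant hG, hsim,
      fun hA => ?_⟩
    rcases hmarks with hmarks | rfl
    -- In the plane no cell is marked, so the general simulation is already the one required.
    · rwa [hmarks] at hsim
    · exact h.simulates hG A HypCA.Line.goodMarks_empty (HypCA.active_label_empty hA)
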